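/- Let $\theta>0$. Let $U_1,U_2,\dots$ be independent random variables, uniform on $(0,1)$, put $V_i=U_i^{1/\theta}$ and $G_i=V_1\cdots V_{i-1}(1-V_i)$, and let $X_1\ge X_2\ge\cdots$ be the sequence $G_1,G_2,\dots$ sorted into descending order. The sequence $(X_1,X_2,\dots)$ is the Poisson–Dirichlet process $\mathrm{PD}(\theta)$; view it as the random multisubset $\{X_1,X_2,\dots\}$ of $(0,1]$. A random multisubset $A$ of $(0,1]$ (at most countable, with finite multiplicities) is one for which the counts $|A\cap S|$, with multiplicity, are random variables for all Borel sets $S$; its distribution is given by the joint distributions of finitely many such counts. For $k\ge1$, say that $A$ has $k$-fold multi-intensity density $f_k$ if $$\mathbb E\bigl(|A\cap I_1|\cdots|A\cap I_k|\bigr)=\int_{I_1\times\cdots\times I_k} f_k(x_1,\dots,x_k)\,dx_1\cdots dx_k$$ for all pairwise disjoint closed intervals $I_i=[a_i,b_i]$ with $0<a_i<b_i\le1$. Then a random multisubset $A$ of $(0,1]$ has the distribution of $\mathrm{PD}(\theta)$ if and only if both of the following hold: 1. $T:=\sum_{x\in A}x$ (taken with multiplicities) satisfies $\mathbb P(T\le1)=1$;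 2. for every $k=1,2,\dots$, $A$ has the $k$-fold multi-intensity density $$f_k(x_1,\dots,x_k)=\begin{cases}\dfrac{\theta^k(1-t)^{\theta-1}}{x_1\cdots x_k}& \text{if } t<1,\\[1ex] 0&\text{if } t>1,\end{cases}\qquad t=x_1+\cdots+x_k .$$ In particular $\mathrm{PD}(\theta)$ itself has properties 1 and 2, and it is the only distribution of a random multisubset of $(0,1]$ that does. -/

import Mathlib

open MeasureTheory Set
open scoped ENNReal

/-- An at most countable multisubset of `(0,1]`, all of whose multiplicities are finite. -/
structure UnitMultiset where
  /-- the multiplicity of each real number -/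
  mult : ℝ → ℕ
  mem_Ioc : ∀ x, mult x ≠ 0 → x ∈ Ioc (0 : ℝ) 1
  countable_support : (Function.support mult).Countable

namespace UnitMultiset

/-- `|A ∩ S|`, the number of elements of `A` lying in `S`, counted with multiplicity
(possibly infinite). -/
noncomputable def count (A : UnitMultiset) (S : Set ℝ) : ℝ≥0∞ :=
  ∑' x : S, (A.mult x : ℝ≥0∞)

/-- The sum of all elements of `A`, taken with multiplicities (possibly infinite). -/
noncomputable def sum (A : UnitMultiset) : ℝ≥0∞ :=
  ∑' x : ℝ, (A.mult x : ℝ≥0∞) * ENNReal.ofReal x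

/-- The σ-algebra generated by the counts `A ↦ |A ∩ S|`, `S` Borel. A random multisubset of
`(0,1]` is a measurable map into `UnitMultiset`, and its law is determined by the joint
distributions of finitely many counts. -/
noncomputable instance instMeasurableSpace : MeasurableSpace UnitMultiset :=
  ⨆ (S : Set ℝ) (_ : MeasurableSet S),
    MeasurableSpace.comap (fun A : UnitMultiset => A.count S) inferInstance

open scoped Classical in
/-- The multiset `{X 0, X 1, …}` of those terms of a sequence that lie in `(0,1]`; the multiplicity
of `x` is the number of indices `n` with `X n = x`. (A value taken infinitely often is discarded;
this does not happen for a sequence with finite sum.) -/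
noncomputable def ofSeq (X : ℕ → ℝ) : UnitMultiset where
  mult x := if x ∈ Ioc (0 : ℝ) 1 then {n | X n = x}.ncard else 0
  mem_Ioc x hx := by
    by_contra h
    exact hx (if_neg h)
  countable_support := by
    refine (countable_range X).mono fun x hx => ?_
    by_contra h
    have he : {n | X n = x} = ∅ := by
      ext n
      simp only [mem_ofPred_eq, mem_empty_iff_false, iff_false]
      exact fun hn => h ⟨n, hn⟩
    exact hx (by simp [he])

end UnitMultiset

/-- The stick-breaking sequence built from `u 0, u 1, …`: with `V i = (u i)^(1/θ)`, its `n`-th term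
is `V 0 * ⋯ * V (n-1) * (1 - V n)`. If the `u i` are independent and uniform on `(0,1)`, this is
the GEM(θ) process. -/
noncomputable def gem (θ : ℝ) (u : ℕ → ℝ) (n : ℕ) : ℝ :=
  (∏ i ∈ Finset.range n, u i ^ (1 / θ)) * (1 - u n ^ (1 / θ))

/-- The ranked version of a sequence `g` of nonnegative reals tending to `0`: `ranked g n` is the
`(n+1)`-st largest term of `g`, counted with multiplicity, i.e. the largest `x ≥ 0` such that at
least `n + 1` terms of `g` are `≥ x`. -/
noncomputable def ranked (g : ℕ → ℝ) (n : ℕ) : ℝ :=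
  sSup {x : ℝ | 0 ≤ x ∧ ((n + 1 : ℕ) : ℕ∞) ≤ {i | x ≤ g i}.encard}

/-- The law of a sequence of independent uniform random variables on `(0,1)`. -/
noncomputable def iidUniform : Measure (ℕ → ℝ) :=
  Measure.infinitePi fun _ : ℕ => (volume : Measure ℝ).restrict (Ioo 0 1)

/-- The law, on sequences, of the Poisson–Dirichlet process `(X_1, X_2, …)` with parameter `θ`:
the ranked version of the GEM(θ) process. -/
noncomputable def poissonDirichlet (θ : ℝ) : Measure (ℕ → ℝ) :=
  iidUniform.map fun u => ranked (gem θ u)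

/-- The law of the Poisson–Dirichlet process viewed as the random multiset `{X_1, X_2, …}`. -/
noncomputable def poissonDirichletMultiset (θ : ℝ) : Measure UnitMultiset :=
  (poissonDirichlet θ).map UnitMultiset.ofSeq

/-- The random multiset `A` has `k`-fold multi-intensity density `f`:
`𝔼 (|A ∩ I_1| ⋯ |A ∩ I_k|) = ∫_{I_1 × ⋯ × I_k} f` for all pairwise disjoint closed intervals
`I_i = [a_i, b_i] ⊆ (0,1]`. -/
def HasMultiIntensityDensity {Ω : Type*} [MeasurableSpace Ω] (P : Measure Ω)
    (A : Ω → UnitMultiset) (k : ℕ) (f : (Fin k → ℝ) → ℝ≥0∞) : Prop :=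
  ∀ a b : Fin k → ℝ, (∀ i, 0 < a i ∧ a i < b i ∧ b i ≤ 1) →
    (Pairwise fun i j => Disjoint (Icc (a i) (b i)) (Icc (a j) (b j))) →
    ∫⁻ ω, ∏ i, (A ω).count (Icc (a i) (b i)) ∂P
      = ∫⁻ x in Set.pi univ (fun i => Icc (a i) (b i)), f x

/-- The function `θ^k (1-t)^(θ-1) / (x_1 ⋯ x_k)` if `t < 1` and `0` otherwise, where
`t = x_1 + ⋯ + x_k` (the hyperplane `t = 1` is a null set). -/
noncomputable def pdDensity (θ : ℝ) (k : ℕ) (x : Fin k → ℝ) : ℝ≥0∞ :=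
  if ∑ i, x i < 1 then
    ENNReal.ofReal (θ ^ k * (1 - ∑ i, x i) ^ (θ - 1) / ∏ i, x i)
  else 0

/-! PD(θ) has the stated intensities because of a renewal argument. Breaking one piece off a stick
of length `r` leaves a stick of length `r V` carrying a scaled copy of the whole process. The mean
of `N(I_1) ⋯ N(I_k)`, as a function of `r`, therefore satisfies a linear equation: the average of
the same mean over the remaining length, plus terms in which the first piece falls into one `I_j`
and an intensity of order `k - 1` is left over. The explicit integral satisfies the same equation
(`intensityIntegral_renewal`). Solutions are unique (`eq_of_renewal`), since averaging multiplies
`r` by `𝔼 V = θ/(θ+1) < 1`. Induction on `k` concludes.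

For uniqueness, intensities over disjoint intervals do not see multiplicities, and the bound `T ≤ 1`
fills the gap. The densities `f_1` and `f_2` assign to `∑ x² + ∑ x y` (over pairs of distinct
positions) the expectation exactly 1, while `𝔼 T² ≤ 1`. A multiple point would push `𝔼 T²` strictly
above 1, so the multiset is almost surely simple (`ae_mult_le_one`).

For a simple multiset with `T ≤ 1`, the product of `1 - N_j` over the dyadic cells of a set tends,
under refinement, to the indicator that the set is empty. Its expectation expands into moments over
distinct cells, so void probabilities are determined (`measure_void_eq`). Void events form a
π-system that generates all counts of simple multisets (`measurable_of_void`), so the law is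
determined. -/

/-! ### Multisets as counting measures; measurability of counts, of the sum and of `ofSeq`. -/

namespace UnitMultiset

/-- The counting measure of a multiset. -/
noncomputable def toMeasure (A : UnitMultiset) : Measure ℝ :=
  Measure.sum fun x : ℝ => (A.mult x : ℝ≥0∞) • Measure.dirac x

theorem toMeasure_apply (A : UnitMultiset) {S : Set ℝ} (hS : MeasurableSet S) :
    A.toMeasure S = A.count S := by
  rw [toMeasure, Measure.sum_apply _ hS, count, tsum_subtype S fun x => (A.mult x : ℝ≥0∞)]
  refine tsum_congr fun x => ?_
  by_cases hx : x ∈ S <;> simp [hS, hx]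

theorem measurable_count {S : Set ℝ} (hS : MeasurableSet S) :
    Measurable fun A : UnitMultiset => A.count S := by
  refine Measurable.of_comap_le ?_
  exact le_iSup₂_of_le (f := fun (S : Set ℝ) (_ : MeasurableSet S) =>
    MeasurableSpace.comap (fun A : UnitMultiset => A.count S) inferInstance) S hS le_rfl

theorem measurable_of_count {α : Type*} [MeasurableSpace α] {B : α → UnitMultiset}
    (h : ∀ S : Set ℝ, MeasurableSet S → Measurable fun a => (B a).count S) : Measurable B := by
  rw [measurable_iff_comap_le]
  simp only [instMeasurableSpace, MeasurableSpace.comap_iSup, MeasurableSpace.comap_comp]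
  exact iSup₂_le fun S hS => (h S hS).comap_le

theorem measurable_toMeasure : Measurable toMeasure := by
  refine Measure.measurable_of_measurable_coe _ fun S hS => ?_
  simpa only [toMeasure_apply _ hS] using measurable_count hS

theorem lintegral_toMeasure (A : UnitMultiset) (f : ℝ → ℝ≥0∞) :
    ∫⁻ x, f x ∂A.toMeasure = ∑' x, (A.mult x : ℝ≥0∞) * f x := by
  simp [toMeasure, lintegral_sum_measure]

theorem sum_eq_lintegral (A : UnitMultiset) :
    A.sum = ∫⁻ x, ENNReal.ofReal x ∂A.toMeasure := by
  rw [lintegral_toMeasure, sum]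

theorem measurable_sum : Measurable sum := by
  have : (sum : UnitMultiset → ℝ≥0∞) = fun A => ∫⁻ x, ENNReal.ofReal x ∂A.toMeasure :=
    funext sum_eq_lintegral
  rw [this]
  exact (Measure.measurable_lintegral ENNReal.measurable_ofReal).comp measurable_toMeasure

theorem ofReal_mul_count_le_sum (A : UnitMultiset) {a : ℝ} {S : Set ℝ} (hS : MeasurableSet S)
    (h : ∀ x ∈ S, a ≤ x) : ENNReal.ofReal a * A.count S ≤ A.sum := by
  rw [sum_eq_lintegral, ← toMeasure_apply A hS, ← setLIntegral_const]
  exact (setLIntegral_mono ENNReal.measurable_ofReal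
    fun x hx => ENNReal.ofReal_le_ofReal (h x hx)).trans (setLIntegral_le_lintegral _ _)

/-- Markov's inequality: each point of `S` uses up at least `a` of the total sum. This deterministic
bound supplies the domination in the later limits. -/
theorem count_le (A : UnitMultiset) (hA : A.sum ≤ 1) {a : ℝ} (ha : 0 < a) {S : Set ℝ}
    (hS : MeasurableSet S) (h : ∀ x ∈ S, a ≤ x) : A.count S ≤ ENNReal.ofReal (1 / a) := by
  have := (A.ofReal_mul_count_le_sum hS h).trans hA
  rw [one_div, ENNReal.ofReal_inv_of_pos ha, ENNReal.le_inv_iff_mul_le, mul_comm]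
  exact this

theorem count_lt_top (A : UnitMultiset) (hA : A.sum ≤ 1) {a : ℝ} (ha : 0 < a) {S : Set ℝ}
    (hS : MeasurableSet S) (h : ∀ x ∈ S, a ≤ x) : A.count S < ∞ :=
  (A.count_le hA ha hS h).trans_lt ENNReal.ofReal_lt_top

/-- Trades the sum over all reals for a countable sum over indices, from which measurability in `X`
can be read off. The indicator records which values `ofSeq` keeps. -/
theorem lintegral_toMeasure_ofSeq (X : ℕ → ℝ) (f : ℝ → ℝ≥0∞) :
    ∫⁻ x, f x ∂(ofSeq X).toMeasure
      = ∑' n, {Y : ℕ → ℝ | Y n ∈ Ioc 0 1 ∧ {m | Y m = Y n}.Finite}.indicator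
          (fun Y => f (Y n)) X := by
  classical
  have h1 : ∀ x, ((ofSeq X).mult x : ℝ≥0∞)
      = ∑' n, if X n = x then (if x ∈ Ioc 0 1 ∧ {m | X m = x}.Finite then 1 else 0) else 0 := by
    intro x
    by_cases h : x ∈ Ioc 0 1 ∧ {m | X m = x}.Finite
    · have e : ∀ n, (if X n = x then (1 : ℝ≥0∞) else 0) = {m | X m = x}.indicator 1 n := by
        intro n; simp [indicator]
      simp only [h, ofSeq, if_true, e, and_self]
      rw [← tsum_subtype {m | X m = x} (1 : ℕ → ℝ≥0∞)]
      simp only [Pi.one_apply, ENNReal.tsum_one, Set.ncard]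
      rw [← ENat.toENNReal_coe]
      congr 1
      rw [ENat.natCast_toNat]
      · rfl
      · exact encard_ne_top_iff.2 h.2
    · simp only [h, if_false, ite_self, tsum_zero, Nat.cast_eq_zero, ofSeq]
      split_ifs with h'
      -- The `ncard` of an infinite set is 0, so infinitely repeated values drop out on both sides.
      · exact Set.Infinite.ncard fun h2 => h ⟨h', h2⟩
      · rfl
  rw [lintegral_toMeasure]
  simp_rw [h1, ← ENNReal.tsum_mul_right]
  rw [ENNReal.tsum_comm]
  refine tsum_congr fun n => ?_
  rw [tsum_eq_single (X n)]
  · simp [indicator]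
  · intro x hx
    simp [hx.symm]

theorem count_ofSeq (X : ℕ → ℝ) {S : Set ℝ} (hS : MeasurableSet S) :
    (ofSeq X).count S
      = ∑' n, {Y : ℕ → ℝ | Y n ∈ Ioc 0 1 ∧ {m | Y m = Y n}.Finite}.indicator
          (fun Y => S.indicator 1 (Y n)) X := by
  rw [← toMeasure_apply _ hS, ← lintegral_indicator_one hS, lintegral_toMeasure_ofSeq]

theorem measurable_ofSeq : Measurable ofSeq := by
  refine measurable_of_count fun S hS => ?_
  simp_rw [count_ofSeq _ hS]
  refine Measurable.tsum fun n => Measurable.indicator ?_ ?_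
  · exact (measurable_const.indicator hS).comp (measurable_pi_apply n)
  · have : {Y : ℕ → ℝ | {m | Y m = Y n}.Finite}
        = ⋃ N : ℕ, ⋂ m : ℕ, ⋂ _ : N < m, {Y | Y m = Y n}ᶜ := by
      ext Y
      simp only [mem_ofPred_eq, mem_iUnion, mem_iInter, mem_compl_iff]
      constructor
      · intro h
        obtain ⟨N, hN⟩ := h.bddAbove
        exact ⟨N, fun m hm h' => absurd (hN h') (by omega)⟩
      · rintro ⟨N, hN⟩
        exact (finite_Iic N).subset fun m hm => not_lt.1 fun h => hN m h hm
    have h2 : MeasurableSet {Y : ℕ → ℝ | {m | Y m = Y n}.Finite} := by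
      rw [this]
      exact .iUnion fun N => .iInter fun m => .iInter fun _ =>
        (measurableSet_eq_fun (measurable_pi_apply m) (measurable_pi_apply n)).compl
    exact (measurable_pi_apply n measurableSet_Ioc).inter h2

end UnitMultiset

/-! ### Ranking a null sequence does not change its multiset of positive values. -/

section Ranked

open Filter Topology

theorem ranked_nonneg (g : ℕ → ℝ) (n : ℕ) : 0 ≤ ranked g n :=
  Real.sSup_nonneg fun _ hx => hx.1

theorem finite_setOf_le_of_tendsto {g : ℕ → ℝ} (h0 : Tendsto g atTop (𝓝 0)) {x : ℝ} (hx : 0 < x) :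
    {i | x ≤ g i}.Finite := by
  have := h0.eventually_lt_const hx
  rw [← Nat.cofinite_eq_atTop, eventually_cofinite] at this
  simpa using this

/-- The supremum is attained: only finitely many terms exceed `x / 2`, so some `y < x` has no term
in `[y, x)`, and any admissible level above `y` has its level set inside that of `x`. -/
theorem le_ranked_iff {g : ℕ → ℝ} (h0 : Tendsto g atTop (𝓝 0)) (n : ℕ) {x : ℝ} (hx : 0 < x) :
    x ≤ ranked g n ↔ ((n + 1 : ℕ) : ℕ∞) ≤ {i | x ≤ g i}.encard := by
  have hbdd : BddAbove {x : ℝ | 0 ≤ x ∧ ((n + 1 : ℕ) : ℕ∞) ≤ {i | x ≤ g i}.encard} := by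
    obtain ⟨M, hM⟩ := h0.bddAbove_range
    refine ⟨M, fun y hy => ?_⟩
    have : {i | y ≤ g i}.encard ≠ 0 := by
      intro h
      have h2 := hy.2
      rw [h] at h2
      simp at h2
    obtain ⟨i, hi⟩ := encard_ne_zero.1 this
    exact le_trans hi (hM ⟨i, rfl⟩)
  refine ⟨fun h => ?_, fun h => le_csSup hbdd ⟨hx.le, h⟩⟩
  have hF := finite_setOf_le_of_tendsto h0 (half_pos hx)
  have h1 : ∀ᶠ y in 𝓝[<] x, ∀ i ∈ {i | x / 2 ≤ g i}, g i < x → g i < y := by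
    rw [eventually_all_finite hF]
    intro i _
    by_cases hi : g i < x
    · filter_upwards [Ioo_mem_nhdsLT hi] with y hy _ using hy.1
    · exact Eventually.of_forall fun y h => absurd h hi
  obtain ⟨y, hy1, hy2⟩ := (h1.and (Ioo_mem_nhdsLT (half_lt_self hx))).exists
  -- The supremum of the empty set is 0, which would contradict `0 < x ≤ ranked g n`.
  have hne : {x : ℝ | 0 ≤ x ∧ ((n + 1 : ℕ) : ℕ∞) ≤ {i | x ≤ g i}.encard}.Nonempty := by
    by_contra he
    rw [not_nonempty_iff_eq_empty] at he
    rw [ranked, he, Real.sSup_empty] at h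
    exact absurd hx (not_lt.2 h)
  obtain ⟨z, hz, hyz⟩ := exists_lt_of_lt_csSup (s := {x : ℝ | 0 ≤ x ∧
    ((n + 1 : ℕ) : ℕ∞) ≤ {i | x ≤ g i}.encard}) hne (hy2.2.trans_le h)
  refine hz.2.trans (encard_le_encard fun i hi => ?_)
  by_contra hc
  simp only [mem_ofPred_eq, not_le] at hc hi
  have : y ≤ g i := hyz.le.trans hi
  exact absurd (hy1 i (show x / 2 ≤ g i by linarith [hy2.1]) hc) (not_lt.2 this)

theorem lt_ranked_iff {g : ℕ → ℝ} (h0 : Tendsto g atTop (𝓝 0)) (n : ℕ) {x : ℝ} (hx : 0 < x) :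
    x < ranked g n ↔ ((n + 1 : ℕ) : ℕ∞) ≤ {i | x < g i}.encard := by
  constructor
  · intro h
    refine ((le_ranked_iff h0 n (hx.trans h)).1 le_rfl).trans (encard_le_encard fun i hi => ?_)
    exact lt_of_lt_of_le h hi
  · intro h
    have h1 : ∀ᶠ y in 𝓝[>] x, ∀ i ∈ {i | x ≤ g i}, x < g i → y ≤ g i := by
      rw [eventually_all_finite (finite_setOf_le_of_tendsto h0 hx)]
      intro i _
      by_cases hi : x < g i
      · filter_upwards [Ioo_mem_nhdsGT hi] with y hy _ using hy.2.le
      · exact Eventually.of_forall fun y h => absurd h hi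
    obtain ⟨y, hy1, hy2⟩ := (h1.and self_mem_nhdsWithin).exists
    have hxy : x < y := hy2
    refine hxy.trans_le ((le_ranked_iff h0 n (hx.trans hxy)).2 (h.trans (encard_le_encard ?_)))
    exact fun i (hi : x < g i) => hy1 i hi.le hi

/-- The ranks at which the value is `x` are exactly those from the number of terms `> x` up to, but
excluding, the number of terms `≥ x`. -/
theorem ncard_ranked_eq {g : ℕ → ℝ} (h0 : Tendsto g atTop (𝓝 0)) {x : ℝ} (hx : 0 < x) :
    {n | ranked g n = x}.ncard = {i | g i = x}.ncard := by
  have hF := finite_setOf_le_of_tendsto h0 hx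
  have hF' : {i | x < g i}.Finite := hF.subset fun i (hi : x < g i) => hi.le
  have key : ∀ s : Set ℕ, s.Finite → {n : ℕ | ((n + 1 : ℕ) : ℕ∞) ≤ s.encard} = Iio s.ncard := by
    intro s hs
    ext n
    rw [← hs.cast_ncard_eq]
    simp only [mem_ofPred_eq, mem_Iio, Nat.cast_le]
    omega
  have e1 : {n | ranked g n = x} = Iio {i | x ≤ g i}.ncard \ Iio {i | x < g i}.ncard := by
    rw [← key _ hF, ← key _ hF']
    ext n
    simp only [Set.mem_sdiff, mem_ofPred_eq]
    rw [← le_ranked_iff h0 n hx, ← lt_ranked_iff h0 n hx]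
    constructor
    · rintro rfl; simp
    · rintro ⟨h1, h2⟩; linarith
  have e2 : {i | g i = x} = {i | x ≤ g i} \ {i | x < g i} := by
    ext i
    simp only [Set.mem_sdiff, mem_ofPred_eq]
    constructor
    · rintro rfl; simp
    · rintro ⟨h1, h2⟩; linarith
  have hsub : {i | x < g i} ⊆ {i | x ≤ g i} := fun i (hi : x < g i) => hi.le
  rw [e1, e2, ncard_sdiff hsub hF', ncard_sdiff _ (finite_Iio _)]
  · simp
  · exact Iio_subset_Iio (ncard_le_ncard hsub hF)

theorem ofSeq_ranked {g : ℕ → ℝ} (h0 : Tendsto g atTop (𝓝 0)) :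
    UnitMultiset.ofSeq (ranked g) = UnitMultiset.ofSeq g := by
  simp only [UnitMultiset.ofSeq, UnitMultiset.mk.injEq]
  funext x
  split_ifs with hx
  · exact ncard_ranked_eq h0 hx.1
  · rfl

/-- Only null sequences matter, so a measurable modification suffices. For `x > 0`, the event that
the rank-`n` value is at least `x` is a countable union over the `(n + 1)`-element sets of indices.
-/
theorem exists_measurable_eq_ranked : ∃ R : (ℕ → ℝ) → ℕ → ℝ, Measurable R ∧
    ∀ g, Tendsto g atTop (𝓝 0) → R g = ranked g := by
  classical
  refine ⟨fun g => if Tendsto g atTop (𝓝 0) then ranked g else 0, ?_, fun g hg => if_pos hg⟩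
  have hT : MeasurableSet {g : ℕ → ℝ | Tendsto g atTop (𝓝 0)} :=
    measurableSet_tendsto (𝓝 0) fun i => measurable_pi_apply i
  refine measurable_pi_lambda _ fun n => measurable_of_Ici fun x => ?_
  by_cases hx : 0 < x
  · have : (fun g : ℕ → ℝ => (if Tendsto g atTop (𝓝 0) then ranked g else 0) n) ⁻¹' Ici x
        = {g | Tendsto g atTop (𝓝 0)} ∩
          ⋃ s : {s : Finset ℕ // s.card = n + 1}, ⋂ i ∈ s.1, {g | x ≤ g i} := by
      ext g
      simp only [mem_preimage, mem_Ici, mem_inter_iff, mem_ofPred_eq, mem_iUnion, mem_iInter]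
      by_cases hg : Tendsto g atTop (𝓝 0)
      · rw [if_pos hg, le_ranked_iff hg n hx]
        simp only [hg, true_and]
        constructor
        · intro h
          obtain ⟨t, ht, htc⟩ := exists_subset_encard_eq h
          have hft : t.Finite := finite_of_encard_eq_coe htc
          refine ⟨⟨hft.toFinset, ?_⟩, fun i hi => ht (by simpa using hi)⟩
          rw [← ncard_eq_toFinset_card t hft, ncard, htc]; rfl
        · rintro ⟨⟨s, hs⟩, h⟩
          rw [← hs, ← encard_coe_eq_coe_finsetCard]
          exact encard_le_encard fun i hi => h i hi
      · simp [hg, hx]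
    rw [this]
    exact hT.inter (.iUnion fun s => .biInter s.1.countable_toSet fun i _ =>
      measurableSet_le measurable_const (measurable_pi_apply i))
  · convert MeasurableSet.univ
    rw [eq_univ_iff_forall]
    intro g
    simp only [mem_preimage, mem_Ici]
    refine (not_lt.1 hx).trans ?_
    split_ifs
    · exact ranked_nonneg g n
    · exact le_rfl

end Ranked

/-! ### Deterministic properties of the stick-breaking sequence. -/

section Gem

open Filter Topology

variable {θ : ℝ}

theorem measurable_gem (θ : ℝ) : Measurable (gem θ) := by
  refine measurable_pi_lambda _ fun n => ?_
  unfold gem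
  fun_prop

theorem gem_zero (θ : ℝ) (u : ℕ → ℝ) : gem θ u 0 = 1 - u 0 ^ (1 / θ) := by simp [gem]

/-- Self-similarity: after the first break the process restarts on a shorter stick. The renewal
equation for the means comes from this. -/
theorem gem_succ (θ : ℝ) (u : ℕ → ℝ) (n : ℕ) :
    gem θ u (n + 1) = u 0 ^ (1 / θ) * gem θ (fun i => u (i + 1)) n := by
  simp only [gem, Finset.prod_range_succ']
  ring

theorem sum_gem (θ : ℝ) (u : ℕ → ℝ) (n : ℕ) :
    ∑ i ∈ Finset.range n, gem θ u i = 1 - ∏ i ∈ Finset.range n, u i ^ (1 / θ) := by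
  induction n with
  | zero => simp
  | succ n ih => rw [Finset.sum_range_succ, ih, Finset.prod_range_succ, gem]; ring

theorem rpow_mem_Ioo (hθ : 0 < θ) {x : ℝ} (hx : x ∈ Ioo (0 : ℝ) 1) :
    x ^ (1 / θ) ∈ Ioo (0 : ℝ) 1 :=
  ⟨Real.rpow_pos_of_pos hx.1 _, Real.rpow_lt_one hx.1.le hx.2 (by positivity)⟩

theorem gem_pos (hθ : 0 < θ) {u : ℕ → ℝ} (hu : ∀ i, u i ∈ Ioo (0 : ℝ) 1) (n : ℕ) :
    0 < gem θ u n :=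
  mul_pos (Finset.prod_pos fun i _ => (rpow_mem_Ioo hθ (hu i)).1)
    (sub_pos.2 (rpow_mem_Ioo hθ (hu n)).2)

theorem sum_gem_le_one (hθ : 0 < θ) {u : ℕ → ℝ} (hu : ∀ i, u i ∈ Ioo (0 : ℝ) 1) (n : ℕ) :
    ∑ i ∈ Finset.range n, gem θ u i ≤ 1 := by
  rw [sum_gem]
  linarith [Finset.prod_pos fun i (_ : i ∈ Finset.range n) => (rpow_mem_Ioo hθ (hu i)).1]

theorem summable_gem (hθ : 0 < θ) {u : ℕ → ℝ} (hu : ∀ i, u i ∈ Ioo (0 : ℝ) 1) :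
    Summable (gem θ u) :=
  summable_of_sum_range_le (fun n => (gem_pos hθ hu n).le) (sum_gem_le_one hθ hu)

theorem tendsto_gem (hθ : 0 < θ) {u : ℕ → ℝ} (hu : ∀ i, u i ∈ Ioo (0 : ℝ) 1) :
    Tendsto (gem θ u) atTop (𝓝 0) :=
  (summable_gem hθ hu).tendsto_atTop_zero

theorem tsum_ofReal_gem_le_one (hθ : 0 < θ) {u : ℕ → ℝ} (hu : ∀ i, u i ∈ Ioo (0 : ℝ) 1) :
    ∑' n, ENNReal.ofReal (gem θ u n) ≤ 1 := by
  rw [← ENNReal.ofReal_tsum_of_nonneg (fun n => (gem_pos hθ hu n).le) (summable_gem hθ hu)]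
  exact ENNReal.ofReal_le_one.2 (Real.tsum_le_of_sum_range_le (fun n => (gem_pos hθ hu n).le)
    (sum_gem_le_one hθ hu))

theorem gem_le_one (hθ : 0 < θ) {u : ℕ → ℝ} (hu : ∀ i, u i ∈ Ioo (0 : ℝ) 1) (n : ℕ) :
    gem θ u n ≤ 1 := by
  have := (ENNReal.le_tsum n).trans (tsum_ofReal_gem_le_one hθ hu)
  simpa using this

theorem lintegral_toMeasure_ofSeq_gem (hθ : 0 < θ) {u : ℕ → ℝ} (hu : ∀ i, u i ∈ Ioo (0 : ℝ) 1)
    (f : ℝ → ℝ≥0∞) :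
    ∫⁻ x, f x ∂(UnitMultiset.ofSeq (gem θ u)).toMeasure = ∑' n, f (gem θ u n) := by
  rw [UnitMultiset.lintegral_toMeasure_ofSeq]
  refine tsum_congr fun n => indicator_of_mem ?_ _
  refine ⟨⟨gem_pos hθ hu n, gem_le_one hθ hu n⟩, ?_⟩
  exact (finite_setOf_le_of_tendsto (tendsto_gem hθ hu) (gem_pos hθ hu n)).subset
    fun m hm => le_of_eq (Eq.symm hm)

theorem count_ofSeq_gem (hθ : 0 < θ) {u : ℕ → ℝ} (hu : ∀ i, u i ∈ Ioo (0 : ℝ) 1)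
    {S : Set ℝ} (hS : MeasurableSet S) :
    (UnitMultiset.ofSeq (gem θ u)).count S = ∑' n, S.indicator 1 (gem θ u n) := by
  rw [← UnitMultiset.toMeasure_apply _ hS, ← lintegral_indicator_one hS,
    lintegral_toMeasure_ofSeq_gem hθ hu]

theorem sum_ofSeq_gem_le_one (hθ : 0 < θ) {u : ℕ → ℝ} (hu : ∀ i, u i ∈ Ioo (0 : ℝ) 1) :
    (UnitMultiset.ofSeq (gem θ u)).sum ≤ 1 := by
  rw [UnitMultiset.sum_eq_lintegral, lintegral_toMeasure_ofSeq_gem hθ hu]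
  exact tsum_ofReal_gem_le_one hθ hu

end Gem

/-! ### The iid uniform sequence and the law of PD(θ) as an image of it. -/

section Iid

instance isProbabilityMeasure_restrict_Ioo_zero_one :
    IsProbabilityMeasure ((volume : Measure ℝ).restrict (Ioo 0 1)) :=
  ⟨by simp⟩

instance isProbabilityMeasure_iidUniform : IsProbabilityMeasure iidUniform := by
  unfold iidUniform; infer_instance

theorem ae_iidUniform_mem_Ioo : ∀ᵐ u ∂iidUniform, ∀ i, u i ∈ Ioo (0 : ℝ) 1 := by
  rw [ae_all_iff]
  intro i
  have h := (measurePreserving_eval_infinitePi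
    (fun _ : ℕ => (volume : Measure ℝ).restrict (Ioo 0 1)) i).quasiMeasurePreserving
  exact h.ae (ae_restrict_mem measurableSet_Ioo)

/-- A sequence of iid uniform variables is a uniform variable followed by an independent such
sequence. -/
theorem map_cons_iidUniform :
    (((volume : Measure ℝ).restrict (Ioo 0 1)).prod iidUniform).map
      (fun p (n : ℕ) => Nat.casesOn (motive := fun _ => ℝ) n p.1 p.2) = iidUniform := by
  have hm : Measurable (fun (p : ℝ × (ℕ → ℝ)) (n : ℕ) =>
      (Nat.casesOn (motive := fun _ => ℝ) n p.1 p.2 : ℝ)) := by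
    refine measurable_pi_lambda _ fun n => ?_
    cases n with
    | zero => exact measurable_fst
    | succ n => exact (measurable_pi_apply n).comp measurable_snd
  classical
  refine Measure.eq_infinitePi _ fun s t ht => ?_
  obtain ⟨N, hN⟩ := s.bddAbove
  -- Padding with `univ` turns `s` into an initial segment, from which coordinate 0 splits off.
  set t' : ℕ → Set ℝ := fun i => if i ∈ s then t i else univ with ht'
  have ht'm : ∀ i, MeasurableSet (t' i) := fun i => by
    simp only [ht']; split_ifs
    exacts [ht i, .univ]
  have hsub : s ⊆ Finset.range (N + 1) := fun i hi => by
    simpa [Nat.lt_succ_iff] using hN hi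
  have e1 : ∏ i ∈ s, (volume : Measure ℝ).restrict (Ioo 0 1) (t i)
      = ∏ i ∈ Finset.range (N + 1), (volume : Measure ℝ).restrict (Ioo 0 1) (t' i) := by
    rw [← Finset.prod_subset hsub]
    · exact Finset.prod_congr rfl fun i hi => by simp [ht', hi]
    · intro i _ hi
      simp [ht', hi]
  have e2 : (fun (p : ℝ × (ℕ → ℝ)) (n : ℕ) =>
      (Nat.casesOn (motive := fun _ => ℝ) n p.1 p.2 : ℝ)) ⁻¹' ((s : Set ℕ).pi t)
      = t' 0 ×ˢ ((Finset.range N : Finset ℕ) : Set ℕ).pi fun i => t' (i + 1) := by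
    ext p
    simp only [mem_preimage, mem_pi, mem_prod, ht', Finset.mem_coe, Finset.mem_range]
    constructor
    · intro h
      refine ⟨?_, fun i _ => ?_⟩
      · split_ifs with h0
        exacts [h 0 h0, trivial]
      · split_ifs with h0
        exacts [h (i + 1) h0, trivial]
    · rintro ⟨h1, h2⟩ i hi
      cases i with
      | zero => simpa [hi] using h1
      | succ i => simpa [hi] using h2 i (by simpa using hsub hi)
  rw [Measure.map_apply hm (.pi s.countable_toSet fun i _ => ht i), e2, Measure.prod_prod, e1,
    iidUniform, Measure.infinitePi_pi _ fun i _ => ht'm (i + 1), Finset.prod_range_succ', mul_comm]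

end Iid

/-- `Measure.map` is zero along maps that are not a.e.-measurable, so `poissonDirichlet` is the
intended law only because of this fact. -/
theorem aemeasurable_ranked_gem {θ : ℝ} (hθ : 0 < θ) :
    AEMeasurable (fun u => ranked (gem θ u)) iidUniform := by
  obtain ⟨R, hR, h⟩ := exists_measurable_eq_ranked
  refine ⟨fun u => R (gem θ u), hR.comp (measurable_gem θ), ?_⟩
  filter_upwards [ae_iidUniform_mem_Ioo] with u hu using (h _ (tendsto_gem hθ hu)).symm

theorem poissonDirichletMultiset_eq {θ : ℝ} (hθ : 0 < θ) :
    poissonDirichletMultiset θ = iidUniform.map fun u => UnitMultiset.ofSeq (gem θ u) := by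
  rw [poissonDirichletMultiset, poissonDirichlet,
    AEMeasurable.map_map_of_aemeasurable UnitMultiset.measurable_ofSeq.aemeasurable
      (aemeasurable_ranked_gem hθ)]
  refine Measure.map_congr ?_
  filter_upwards [ae_iidUniform_mem_Ioo] with u hu using ofSeq_ranked (tendsto_gem hθ hu)

theorem measurable_ofSeq_gem (θ : ℝ) : Measurable fun u => UnitMultiset.ofSeq (gem θ u) :=
  UnitMultiset.measurable_ofSeq.comp (measurable_gem θ)

theorem isProbabilityMeasure_poissonDirichletMultiset {θ : ℝ} (hθ : 0 < θ) :
    IsProbabilityMeasure (poissonDirichletMultiset θ) := by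
  rw [poissonDirichletMultiset_eq hθ]
  exact Measure.isProbabilityMeasure_map (measurable_ofSeq_gem θ).aemeasurable

theorem ae_sum_le_one_poissonDirichletMultiset {θ : ℝ} (hθ : 0 < θ) :
    ∀ᵐ A ∂poissonDirichletMultiset θ, A.sum ≤ 1 := by
  have hm : MeasurableSet {A : UnitMultiset | A.sum ≤ 1} :=
    UnitMultiset.measurable_sum measurableSet_Iic
  rw [poissonDirichletMultiset_eq hθ, ae_map_iff (measurable_ofSeq_gem θ).aemeasurable hm]
  filter_upwards [ae_iidUniform_mem_Ioo] with u hu using sum_ofSeq_gem_le_one hθ hu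

/-! ### The averaging operator of one break and uniqueness for its renewal equation. -/

section StickOperator

open Filter Topology

variable {θ : ℝ}

theorem lintegral_Ioo_rpow {s r : ℝ} (hs : 0 < s) (hr : 0 < r) :
    ∫⁻ y in Ioo 0 r, ENNReal.ofReal (s * y ^ (s - 1)) = ENNReal.ofReal (r ^ s) := by
  have himg : (fun y : ℝ => y ^ s) '' Ioo 0 r = Ioo 0 (r ^ s) := by
    ext x
    constructor
    · rintro ⟨y, hy, rfl⟩
      exact ⟨Real.rpow_pos_of_pos hy.1 _, Real.rpow_lt_rpow hy.1.le hy.2 hs⟩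
    · rintro ⟨h1, h2⟩
      refine ⟨x ^ s⁻¹, ⟨Real.rpow_pos_of_pos h1 _, ?_⟩, Real.rpow_inv_rpow h1.le hs.ne'⟩
      rwa [Real.rpow_inv_lt_iff_of_pos h1.le hr.le hs]
  have h := lintegral_image_eq_lintegral_abs_deriv_mul (s := Ioo 0 r) measurableSet_Ioo
    (f := fun y : ℝ => y ^ s) (f' := fun y => s * y ^ (s - 1))
    (fun y hy => (Real.hasDerivAt_rpow_const (Or.inl hy.1.ne')).hasDerivWithinAt)
    (fun x hx y hy h => by
      exact (Real.rpow_left_inj hx.1.le hy.1.le hs.ne').1 h) (fun _ => 1)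
  rw [himg] at h
  simp only [mul_one, lintegral_const, one_mul, Measure.restrict_apply MeasurableSet.univ,
    univ_inter, Real.volume_Ioo, sub_zero] at h
  rw [h]
  refine setLIntegral_congr_fun measurableSet_Ioo fun y hy => ?_
  rw [abs_of_pos]
  have := Real.rpow_pos_of_pos hy.1 (s - 1)
  positivity

theorem setLIntegral_Ioo_sub_left (f : ℝ → ℝ≥0∞) (r : ℝ) :
    ∫⁻ y in Ioo 0 r, f (r - y) = ∫⁻ y in Ioo 0 r, f y := by
  rw [← lintegral_indicator measurableSet_Ioo, ← lintegral_indicator measurableSet_Ioo,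
    ← lintegral_sub_left_eq_self _ r]
  refine lintegral_congr fun y => ?_
  by_cases h : y ∈ Ioo 0 r
  · have : r - y ∈ Ioo 0 r := ⟨by linarith [h.2], by linarith [h.1]⟩
    simp [h, this]
  · have : r - y ∉ Ioo 0 r := fun h' => h ⟨by linarith [h'.2], by linarith [h'.1]⟩
    simp [h, this]

theorem lintegral_Ioo_sub_rpow {s r : ℝ} (hs : 0 < s) (hr : 0 < r) :
    ∫⁻ y in Ioo 0 r, ENNReal.ofReal (s * (r - y) ^ (s - 1)) = ENNReal.ofReal (r ^ s) := by
  rw [setLIntegral_Ioo_sub_left fun y => ENNReal.ofReal (s * y ^ (s - 1)), lintegral_Ioo_rpow hs hr]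

/-- The density of what remains of a stick of length `r` after its first break. -/
noncomputable def stickKernel (θ r w : ℝ) : ℝ≥0∞ := ENNReal.ofReal (θ * w ^ (θ - 1) / r ^ θ)

/-- The expectation of `φ` at the remainder of a stick of length `r` after its first break. -/
noncomputable def stickOp (θ : ℝ) (φ : ℝ → ℝ≥0∞) (r : ℝ) : ℝ≥0∞ :=
  ∫⁻ w in Ioo 0 r, stickKernel θ r w * φ w

@[fun_prop]
theorem measurable_stickKernel (θ r : ℝ) : Measurable (stickKernel θ r) := by
  unfold stickKernel; fun_prop

/-- Substitution `u = (w / r) ^ θ`, whose derivative is the kernel. -/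
theorem lintegral_uniform_eq_stickOp (hθ : 0 < θ) {r : ℝ} (hr : 0 < r) (φ : ℝ → ℝ≥0∞) :
    ∫⁻ u in Ioo 0 1, φ (r * u ^ (1 / θ)) = stickOp θ φ r := by
  have himg : (fun w : ℝ => (w / r) ^ θ) '' Ioo 0 r = Ioo 0 1 := by
    ext x
    constructor
    · rintro ⟨y, hy, rfl⟩
      have : 0 < y / r := div_pos hy.1 hr
      exact ⟨Real.rpow_pos_of_pos this _, Real.rpow_lt_one this.le ((div_lt_one hr).2 hy.2) hθ⟩
    · intro hx
      have := rpow_mem_Ioo hθ hx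
      refine ⟨r * x ^ (1 / θ), ⟨mul_pos hr this.1, by nlinarith [this.2]⟩, ?_⟩
      beta_reduce
      rw [mul_div_cancel_left₀ _ hr.ne', one_div, Real.rpow_inv_rpow hx.1.le hθ.ne']
  have hd : ∀ w ∈ Ioo 0 r, HasDerivWithinAt (fun w : ℝ => (w / r) ^ θ)
      (θ * w ^ (θ - 1) / r ^ θ) (Ioo 0 r) w := by
    intro w hw
    have hw' : 0 < w / r := div_pos hw.1 hr
    have := ((hasDerivAt_id w).div_const r).rpow_const (p := θ) (Or.inl hw'.ne')
    refine (this.congr_deriv ?_).hasDerivWithinAt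
    simp only [id]
    rw [Real.div_rpow hw.1.le hr.le, Real.rpow_sub_one hr.ne']
    have := (Real.rpow_pos_of_pos hr θ).ne'
    field_simp
  have h := lintegral_image_eq_lintegral_abs_deriv_mul measurableSet_Ioo hd
    (fun x hx y hy h => by
      have := (Real.rpow_left_inj (div_pos hx.1 hr).le (div_pos hy.1 hr).le hθ.ne').1 h
      exact (div_left_inj' hr.ne').1 this) (fun u => φ (r * u ^ (1 / θ)))
  rw [himg] at h
  rw [h, stickOp]
  refine setLIntegral_congr_fun measurableSet_Ioo fun w hw => ?_
  have h1 : 0 < θ * w ^ (θ - 1) / r ^ θ := by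
    have := Real.rpow_pos_of_pos hw.1 (θ - 1)
    have := Real.rpow_pos_of_pos hr θ
    positivity
  have h2 : r * ((w / r) ^ θ) ^ (1 / θ) = w := by
    rw [one_div, Real.rpow_rpow_inv (div_pos hw.1 hr).le hθ.ne', mul_div_cancel₀ _ hr.ne']
  simp only [h2, abs_of_pos h1, stickKernel]

theorem stickOp_mono {φ ψ : ℝ → ℝ≥0∞} {r : ℝ} (h : ∀ w ∈ Ioo 0 r, φ w ≤ ψ w) :
    stickOp θ φ r ≤ stickOp θ ψ r :=
  setLIntegral_mono' measurableSet_Ioo fun w hw => mul_le_mul_right (h w hw) _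

theorem stickOp_congr {φ ψ : ℝ → ℝ≥0∞} {r : ℝ} (h : ∀ w ∈ Ioo 0 r, φ w = ψ w) :
    stickOp θ φ r = stickOp θ ψ r :=
  setLIntegral_congr_fun measurableSet_Ioo fun w hw => by simp only [h w hw]

theorem stickOp_add {φ ψ : ℝ → ℝ≥0∞} (hφ : Measurable φ) (r : ℝ) :
    stickOp θ (fun w => φ w + ψ w) r = stickOp θ φ r + stickOp θ ψ r := by
  simp only [stickOp, mul_add]
  exact lintegral_add_left (by fun_prop) _

theorem stickOp_finset_sum {ι : Type*} (s : Finset ι) {φ : ι → ℝ → ℝ≥0∞}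
    (hφ : ∀ i, Measurable (φ i)) (r : ℝ) :
    stickOp θ (fun w => ∑ i ∈ s, φ i w) r = ∑ i ∈ s, stickOp θ (φ i) r := by
  simp only [stickOp, Finset.mul_sum]
  exact lintegral_finsetSum _ fun i _ => by have := hφ i; fun_prop

theorem stickOp_const_mul (c : ℝ≥0∞) {φ : ℝ → ℝ≥0∞} (hφ : Measurable φ) (r : ℝ) :
    stickOp θ (fun w => c * φ w) r = c * stickOp θ φ r := by
  simp only [stickOp, mul_left_comm _ c]
  exact lintegral_const_mul _ (by fun_prop)

/-- The identity is an eigenfunction with eigenvalue `𝔼 V < 1`; this is the contraction behind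
uniqueness. -/
theorem stickOp_ofReal (hθ : 0 < θ) {r : ℝ} (hr : 0 < r) :
    stickOp θ ENNReal.ofReal r = ENNReal.ofReal (θ / (θ + 1)) * ENNReal.ofReal r := by
  have h : ∀ w ∈ Ioo 0 r, stickKernel θ r w * ENNReal.ofReal w
      = ENNReal.ofReal (θ / (θ + 1) / r ^ θ) * ENNReal.ofReal ((θ + 1) * w ^ (θ + 1 - 1)) := by
    intro w hw
    have h1 := Real.rpow_pos_of_pos hw.1 (θ - 1)
    have h2 := Real.rpow_pos_of_pos hr θ
    rw [stickKernel, ← ENNReal.ofReal_mul (by positivity), ← ENNReal.ofReal_mul (by positivity)]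
    congr 1
    rw [add_sub_cancel_right, Real.rpow_sub_one hw.1.ne']
    have := hw.1
    field_simp
  rw [stickOp, setLIntegral_congr_fun measurableSet_Ioo h, lintegral_const_mul' _ _ (by simp),
    lintegral_Ioo_rpow (by positivity) hr, ← ENNReal.ofReal_mul (by positivity),
    ← ENNReal.ofReal_mul (by positivity), Real.rpow_add_one hr.ne']
  congr 1
  have h2 := Real.rpow_pos_of_pos hr θ
  field_simp

/-- Substituting the equation into itself `n` times leaves an error of at most `D β ^ n r`, which
tends to 0. The bound is required of `stickOp θ e` rather than of `e`, because averaging turns the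
possibly unbounded power `θ - 1` of the densities into the bounded power `θ`. Only inequalities are
used, as subtraction is unavailable in `ℝ≥0∞`. -/
theorem stickOp_le_of_renewal (hθ : 0 < θ) {e f c : ℝ → ℝ≥0∞} (hf : Measurable f)
    (he' : ∀ r ∈ Ioc (0 : ℝ) 1, e r = stickOp θ e r + c r)
    (hf' : ∀ r ∈ Ioc (0 : ℝ) 1, f r = stickOp θ f r + c r)
    {ε : ℝ} (hε : 0 < ε) (h0 : ∀ r < ε, e r = 0) {C : ℝ≥0∞} (hC : C ≠ ∞)
    (heC : ∀ r ∈ Ioc (0 : ℝ) 1, stickOp θ e r ≤ C) {r : ℝ} (hr : r ∈ Ioc (0 : ℝ) 1) :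
    stickOp θ e r ≤ stickOp θ f r := by
  set β := ENNReal.ofReal (θ / (θ + 1)) with hβ
  -- Chosen so that `C ≤ D r` for `r ≥ ε`; for `r < ε` the equation forces `stickOp θ e r = 0`.
  set D := C / ENNReal.ofReal ε
  have key : ∀ n : ℕ, ∀ r ∈ Ioc (0 : ℝ) 1,
      stickOp θ e r ≤ stickOp θ f r + D * β ^ n * ENNReal.ofReal r := by
    intro n
    induction n with
    | zero =>
      intro r hr
      rw [pow_zero, mul_one]
      rcases lt_or_ge r ε with h | h
      · have : stickOp θ e r = 0 := by
          have := he' r hr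
          rw [h0 r h] at this
          exact (add_eq_zero.1 this.symm).1
        simp [this]
      · refine (heC r hr).trans (le_trans ?_ le_add_self)
        calc C = D * ENNReal.ofReal ε := by
              rw [ENNReal.div_mul_cancel]
              · simpa using hε
              · simp
          _ ≤ _ := by gcongr
    | succ n ih =>
      intro r hr
      calc stickOp θ e r
          ≤ stickOp θ (fun w => f w + D * β ^ n * ENNReal.ofReal w) r := by
            refine stickOp_mono fun w hw => ?_
            have hw' : w ∈ Ioc (0 : ℝ) 1 := ⟨hw.1, hw.2.le.trans hr.2⟩
            rw [he' w hw', hf' w hw', add_right_comm]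
            gcongr
            exact ih w hw'
        _ = _ := by
            rw [stickOp_add hf, stickOp_const_mul _ ENNReal.measurable_ofReal,
              stickOp_ofReal hθ hr.1, pow_succ]
            ring
  have hlim : Tendsto (fun n : ℕ => stickOp θ f r + D * β ^ n * ENNReal.ofReal r) atTop
      (𝓝 (stickOp θ f r + D * 0 * ENNReal.ofReal r)) := by
    refine tendsto_const_nhds.add (ENNReal.Tendsto.mul_const (ENNReal.Tendsto.const_mul
      (ENNReal.tendsto_pow_atTop_nhds_zero_of_lt_one ?_) (Or.inr ?_)) (Or.inr (by simp)))
    · rw [hβ]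
      exact ENNReal.ofReal_lt_one.2 ((div_lt_one (by positivity)).2 (by linarith))
    · exact ENNReal.div_ne_top hC (by simpa using hε)
  simpa using ge_of_tendsto' hlim fun n => key n r hr

/-- Bounded solutions of the renewal equation `e = stickOp θ e + c` that vanish near `0` are
unique. -/
theorem eq_of_renewal (hθ : 0 < θ) {e f c : ℝ → ℝ≥0∞} (he : Measurable e) (hf : Measurable f)
    (he' : ∀ r ∈ Ioc (0 : ℝ) 1, e r = stickOp θ e r + c r)
    (hf' : ∀ r ∈ Ioc (0 : ℝ) 1, f r = stickOp θ f r + c r)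
    {ε : ℝ} (hε : 0 < ε) (he0 : ∀ r < ε, e r = 0) (hf0 : ∀ r < ε, f r = 0)
    {C C' : ℝ≥0∞} (hC : C ≠ ∞) (hC' : C' ≠ ∞)
    (heC : ∀ r ∈ Ioc (0 : ℝ) 1, stickOp θ e r ≤ C)
    (hfC : ∀ r ∈ Ioc (0 : ℝ) 1, stickOp θ f r ≤ C') {r : ℝ} (hr : r ∈ Ioc (0 : ℝ) 1) :
    e r = f r := by
  rw [he' r hr, hf' r hr, le_antisymm (stickOp_le_of_renewal hθ hf he' hf' hε he0 hC heC hr)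
    (stickOp_le_of_renewal hθ he hf' he' hε hf0 hC' hfC hr)]

end StickOperator

/-! ### The explicit intensity integral solves the renewal equation. -/

section StickDensity

variable {θ : ℝ}

/-- The factor `((w - t) / w)^(θ - 1)` of the intensity density of the sticks broken from a stick
of length `w`. -/
noncomputable def stickDensity (θ w t : ℝ) : ℝ≥0∞ :=
  if t < w then ENNReal.ofReal (((w - t) / w) ^ (θ - 1)) else 0

theorem measurable_stickDensity (θ : ℝ) :
    Measurable fun p : ℝ × ℝ => stickDensity θ p.1 p.2 := by
  unfold stickDensity
  exact Measurable.ite (measurableSet_lt measurable_snd measurable_fst) (by fun_prop)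
    measurable_const

/-- The kernel cancels the denominator `w ^ (θ - 1)`, and integrating `(w - t) ^ (θ - 1)` over `w`
in `(t, r)` raises the exponent to `θ`. -/
theorem stickOp_stickDensity (hθ : 0 < θ) {r t : ℝ} (hr : 0 < r) (ht : 0 ≤ t) :
    stickOp θ (fun w => stickDensity θ w t) r
      = if t < r then ENNReal.ofReal (((r - t) / r) ^ θ) else 0 := by
  split_ifs with h
  · have hp := Real.rpow_pos_of_pos hr θ
    have e : stickOp θ (fun w => stickDensity θ w t) r
        = ∫⁻ y in Ioo 0 r, (Ioo 0 (r - t)).indicator (fun y => ENNReal.ofReal (1 / r ^ θ) *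
          ENNReal.ofReal (θ * ((r - t) - y) ^ (θ - 1))) y := by
      rw [stickOp, ← setLIntegral_Ioo_sub_left]
      refine setLIntegral_congr_fun measurableSet_Ioo fun y hy => ?_
      simp only [stickDensity]
      by_cases hy' : t < r - y
      · have hyy : y ∈ Ioo 0 (r - t) := ⟨hy.1, by linarith⟩
        have h1 : 0 < r - y := by linarith
        have h2 : 0 < r - t - y := by linarith
        have h3 := Real.rpow_pos_of_pos h1 (θ - 1)
        have h4 := Real.rpow_pos_of_pos h2 (θ - 1)
        rw [if_pos hy', indicator_of_mem hyy, stickKernel, ← ENNReal.ofReal_mul (by positivity),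
          ← ENNReal.ofReal_mul (by positivity), show r - y - t = r - t - y by ring,
          Real.div_rpow h2.le h1.le]
        congr 1
        field_simp
      · rw [if_neg hy', indicator_of_notMem (fun h => hy' (by linarith [h.2])), mul_zero]
    rw [e, lintegral_indicator measurableSet_Ioo, Measure.restrict_restrict measurableSet_Ioo,
      inter_eq_left.2 (Ioo_subset_Ioo_right (by linarith)), lintegral_const_mul' _ _ (by simp),
      lintegral_Ioo_sub_rpow hθ (by linarith), ← ENNReal.ofReal_mul (by positivity),
      Real.div_rpow (by linarith) hr.le]
    congr 1
    ring
  · have h1 : stickOp θ (fun w => stickDensity θ w t) r = stickOp θ (fun _ => 0) r :=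
      stickOp_congr fun w hw => if_neg (by linarith [hw.2])
    rw [h1]
    simp [stickOp]

/-- The powers of `r - y` cancel, so a first piece `y` followed by pieces of total `t` is weighted
like pieces of total `y + t`. -/
theorem stickKernel_mul_stickDensity (hθ : 0 < θ) {r y t : ℝ} (hr : 0 < r) (hy : y < r) :
    stickKernel θ r (r - y) * stickDensity θ (r - y) t
      = ENNReal.ofReal (θ / r) * stickDensity θ r (y + t) := by
  unfold stickDensity stickKernel
  by_cases h : t < r - y
  · have h1 : 0 < r - y := by linarith
    have h2 : 0 < r - y - t := by linarith
    have h3 := Real.rpow_pos_of_pos h1 (θ - 1)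
    have h4 := Real.rpow_pos_of_pos h2 (θ - 1)
    have h5 := Real.rpow_pos_of_pos hr θ
    have h6 := Real.rpow_pos_of_pos hr (θ - 1)
    rw [if_pos h, if_pos (by linarith), ← ENNReal.ofReal_mul (by positivity),
      ← ENNReal.ofReal_mul (by positivity), Real.div_rpow h2.le h1.le,
      show r - (y + t) = r - y - t by ring, Real.div_rpow h2.le hr.le, Real.rpow_sub_one hr.ne']
    congr 1
    field_simp
  · rw [if_neg h, if_neg (by linarith), mul_zero, mul_zero]

/-- With `x = (r - t) / r` this is `x ^ θ + (1 - x) x ^ (θ - 1) = x ^ (θ - 1)`. The first summand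
stands for none of the marked pieces being broken first, the second for one of them being first. -/
theorem stickDensity_split {r t : ℝ} (hr : 0 < r) (ht : 0 ≤ t) :
    (if t < r then ENNReal.ofReal (((r - t) / r) ^ θ) else 0)
      + ENNReal.ofReal (t / r) * stickDensity θ r t = stickDensity θ r t := by
  unfold stickDensity
  split_ifs with h
  · have h1 : 0 < (r - t) / r := div_pos (by linarith) hr
    have h2 := Real.rpow_pos_of_pos h1 (θ - 1)
    rw [← ENNReal.ofReal_mul (by positivity), ← ENNReal.ofReal_add (by positivity) (by positivity)]
    congr 1
    have : ((r - t) / r) ^ θ = ((r - t) / r) ^ (θ - 1) * ((r - t) / r) := by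
      rw [Real.rpow_sub_one h1.ne', div_mul_cancel₀ _ h1.ne']
    have h3 : t / r = 1 - (r - t) / r := by field_simp; ring
    rw [this, h3]
    ring
  · simp

/-- The claimed value of `𝔼 (N(I_1) ⋯ N(I_k))`, where `N(I)` counts the sticks with length in `I`
that are broken from a stick of length `r`. -/
noncomputable def intensityIntegral (θ : ℝ) {k : ℕ} (a b : Fin k → ℝ) (r : ℝ) : ℝ≥0∞ :=
  ∫⁻ y in univ.pi fun i => Icc (a i) (b i),
    (∏ i, ENNReal.ofReal (θ / y i)) * stickDensity θ r (∑ i, y i)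

variable {k : ℕ}

theorem measurable_intensityIntegrand (θ : ℝ) (k : ℕ) : Measurable fun p : ℝ × (Fin k → ℝ) =>
    (∏ i, ENNReal.ofReal (θ / p.2 i)) * stickDensity θ p.1 (∑ i, p.2 i) := by
  have h1 : Measurable fun p : ℝ × (Fin k → ℝ) => (p.1, ∑ i, p.2 i) := by fun_prop
  have h2 := (measurable_stickDensity θ).comp h1
  have h3 : Measurable fun p : ℝ × (Fin k → ℝ) => ∏ i, ENNReal.ofReal (θ / p.2 i) := by fun_prop
  exact h3.mul h2

theorem measurable_intensityIntegrand_right (θ : ℝ) (k : ℕ) (r : ℝ) :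
    Measurable fun y : Fin k → ℝ =>
      (∏ i, ENNReal.ofReal (θ / y i)) * stickDensity θ r (∑ i, y i) :=
  (measurable_intensityIntegrand θ k).comp (f := fun y : Fin k → ℝ => (r, y)) measurable_prodMk_left

theorem measurable_intensityIntegral (a b : Fin k → ℝ) : Measurable (intensityIntegral θ a b) :=
  (measurable_intensityIntegrand θ k).lintegral_prod_right'

theorem measurableSet_pi_Icc (a b : Fin k → ℝ) :
    MeasurableSet (univ.pi fun i => Icc (a i) (b i)) :=
  .univ_pi fun _ => measurableSet_Icc

theorem stickOp_intensityIntegral (hθ : 0 < θ) {a b : Fin k → ℝ} (ha : ∀ i, 0 < a i) {r : ℝ}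
    (hr : 0 < r) : stickOp θ (intensityIntegral θ a b) r
      = ∫⁻ y in univ.pi fun i => Icc (a i) (b i), (∏ i, ENNReal.ofReal (θ / y i)) *
        if ∑ i, y i < r then ENNReal.ofReal (((r - ∑ i, y i) / r) ^ θ) else 0 := by
  have hm := measurable_intensityIntegrand θ k
  have h1 : stickOp θ (intensityIntegral θ a b) r
      = ∫⁻ w in Ioo 0 r, ∫⁻ y in univ.pi fun i => Icc (a i) (b i), stickKernel θ r w *
        ((∏ i, ENNReal.ofReal (θ / y i)) * stickDensity θ w (∑ i, y i)) := by
    refine lintegral_congr fun w => ?_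
    rw [intensityIntegral, lintegral_const_mul _ (measurable_intensityIntegrand_right θ k w)]
  have hm2 : Measurable (Function.uncurry fun (w : ℝ) (y : Fin k → ℝ) => stickKernel θ r w *
      ((∏ i, ENNReal.ofReal (θ / y i)) * stickDensity θ w (∑ i, y i))) := by
    have : Measurable fun p : ℝ × (Fin k → ℝ) => stickKernel θ r p.1 := by fun_prop
    exact this.mul hm
  rw [h1, lintegral_lintegral_swap hm2.aemeasurable]
  refine setLIntegral_congr_fun (measurableSet_pi_Icc a b) fun y hy => ?_
  have hy0 : 0 ≤ ∑ i, y i := Finset.sum_nonneg fun i _ => (ha i).le.trans (hy i trivial).1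
  rw [← stickOp_stickDensity hθ hr hy0, ← stickOp_const_mul]
  · refine lintegral_congr fun w => ?_
    ring
  · exact (measurable_stickDensity θ).comp (f := fun w => (w, ∑ i, y i)) measurable_prodMk_right

/-- Coordinate `j` plays the first piece. Writing `θ / r = (θ / y) (y / r)` restores the missing
factor of the density and leaves the size-biased weight `y j / r`; these weights add up to `t / r`
over `j`. -/
theorem stickOp_indicator_intensityIntegral (hθ : 0 < θ) {a b : Fin (k + 1) → ℝ}
    (ha : ∀ i, 0 < a i) {r : ℝ} (hr : 0 < r) (j : Fin (k + 1)) :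
    stickOp θ (fun w => (Icc (a j) (b j)).indicator 1 (r - w) *
        intensityIntegral θ (a ∘ j.succAbove) (b ∘ j.succAbove) w) r
      = ∫⁻ y in univ.pi fun i => Icc (a i) (b i), (∏ i, ENNReal.ofReal (θ / y i)) *
        (ENNReal.ofReal (y j / r) * stickDensity θ r (∑ i, y i)) := by
  have hmp := volume_preserving_piFinSuccAbove (fun _ : Fin (k + 1) => ℝ) j
  set S := univ.pi fun i => Icc ((a ∘ j.succAbove) i) ((b ∘ j.succAbove) i) with hS
  have hpre : (univ.pi fun i => Icc (a i) (b i))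
      = (MeasurableEquiv.piFinSuccAbove (fun _ : Fin (k + 1) => ℝ) j) ⁻¹'
        (Icc (a j) (b j) ×ˢ S) := by
    ext y
    simp only [mem_univ_pi, mem_preimage, mem_prod, hS, Fin.forall_iff_succAbove j]
    rfl
  have hf : ∀ y : Fin (k + 1) → ℝ, (∏ i, ENNReal.ofReal (θ / y i)) *
        (ENNReal.ofReal (y j / r) * stickDensity θ r (∑ i, y i))
      = (fun p : ℝ × (Fin k → ℝ) => (ENNReal.ofReal (θ / p.1) *
          ∏ i, ENNReal.ofReal (θ / p.2 i)) *
        (ENNReal.ofReal (p.1 / r) * stickDensity θ r (p.1 + ∑ i, p.2 i)))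
        (MeasurableEquiv.piFinSuccAbove (fun _ : Fin (k + 1) => ℝ) j y) := by
    intro y
    rw [Fin.prod_univ_succAbove _ j, Fin.sum_univ_succAbove _ j]
    rfl
  have hmF : Measurable fun p : ℝ × (Fin k → ℝ) => (ENNReal.ofReal (θ / p.1) *
          ∏ i, ENNReal.ofReal (θ / p.2 i)) *
        (ENNReal.ofReal (p.1 / r) * stickDensity θ r (p.1 + ∑ i, p.2 i)) := by
    have h1 : Measurable fun p : ℝ × (Fin k → ℝ) => (r, p.1 + ∑ i, p.2 i) := by fun_prop
    have h2 := (measurable_stickDensity θ).comp h1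
    have h3 : Measurable fun p : ℝ × (Fin k → ℝ) => (ENNReal.ofReal (θ / p.1) *
          ∏ i, ENNReal.ofReal (θ / p.2 i)) := by fun_prop
    have h4 : Measurable fun p : ℝ × (Fin k → ℝ) => ENNReal.ofReal (p.1 / r) := by fun_prop
    exact h3.mul (h4.mul h2)
  simp_rw [hf]
  rw [hpre, hmp.setLIntegral_comp_preimage (measurableSet_Icc.prod (measurableSet_pi_Icc _ _)) hmF,
    Measure.volume_eq_prod, ← Measure.prod_restrict, lintegral_prod _ hmF.aemeasurable,
    ← lintegral_indicator measurableSet_Icc, stickOp, ← setLIntegral_Ioo_sub_left,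
    ← lintegral_indicator measurableSet_Ioo]
  refine lintegral_congr fun y => ?_
  by_cases hy : y ∈ Icc (a j) (b j)
  swap
  · rw [indicator_of_notMem hy]
    by_cases hy' : y ∈ Ioo 0 r <;> simp [hy, hy']
  have hy0 : 0 < y := (ha j).trans_le hy.1
  have hS0 : ∀ z ∈ S, 0 ≤ ∑ i, z i := fun z hz =>
    Finset.sum_nonneg fun i _ => (ha _).le.trans (hz i trivial).1
  rw [indicator_of_mem hy]
  by_cases hy' : y < r
  · rw [indicator_of_mem (show y ∈ Ioo 0 r from ⟨hy0, hy'⟩), sub_sub_cancel, indicator_of_mem hy,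
      Pi.one_apply, one_mul, intensityIntegral, ← lintegral_const_mul _
        (measurable_intensityIntegrand_right θ k _)]
    refine setLIntegral_congr_fun (measurableSet_pi_Icc _ _) fun z hz => ?_
    have := stickKernel_mul_stickDensity hθ hr hy' (t := ∑ i, z i)
    have h2 : ENNReal.ofReal (θ / r) = ENNReal.ofReal (θ / y) * ENNReal.ofReal (y / r) := by
      rw [← ENNReal.ofReal_mul (by positivity)]
      congr 1
      field_simp
    calc _ = (∏ i, ENNReal.ofReal (θ / z i)) *
          (stickKernel θ r (r - y) * stickDensity θ (r - y) (∑ i, z i)) := by ring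
      _ = _ := by rw [this, h2]; ring
  · rw [indicator_of_notMem fun h => hy' h.2]
    symm
    rw [← lintegral_zero (μ := volume.restrict S)]
    refine setLIntegral_congr_fun (measurableSet_pi_Icc _ _) fun z hz => ?_
    have : stickDensity θ r (y + ∑ i, z i) = 0 := if_neg (by linarith [hS0 z hz])
    simp [this]

theorem intensityIntegral_renewal (hθ : 0 < θ) {a b : Fin (k + 1) → ℝ}
    (ha : ∀ i, 0 < a i) {r : ℝ} (hr : 0 < r) :
    intensityIntegral θ a b r = stickOp θ (intensityIntegral θ a b) r
      + ∑ j, stickOp θ (fun w => (Icc (a j) (b j)).indicator 1 (r - w) *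
        intensityIntegral θ (a ∘ j.succAbove) (b ∘ j.succAbove) w) r := by
  have hden : Measurable fun y : Fin (k + 1) → ℝ => stickDensity θ r (∑ i, y i) :=
    (measurable_stickDensity θ).comp (f := fun y : Fin (k + 1) → ℝ => (r, ∑ i, y i)) (by fun_prop)
  have hprod : Measurable fun y : Fin (k + 1) → ℝ => ∏ i, ENNReal.ofReal (θ / y i) := by fun_prop
  have hj : ∀ j, Measurable fun y : Fin (k + 1) → ℝ => ENNReal.ofReal (y j / r) := by fun_prop
  simp_rw [stickOp_indicator_intensityIntegral hθ ha hr]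
  have hF : ∀ j, Measurable fun y : Fin (k + 1) → ℝ => (∏ i, ENNReal.ofReal (θ / y i)) *
      (ENNReal.ofReal (y j / r) * stickDensity θ r (∑ i, y i)) := fun j =>
    hprod.mul ((hj j).mul hden)
  rw [stickOp_intensityIntegral hθ ha hr, ← lintegral_finsetSum _ fun j _ => hF j,
    ← lintegral_add_right]
  · refine setLIntegral_congr_fun (measurableSet_pi_Icc a b) fun y hy => ?_
    have hy0 : ∀ i, 0 ≤ y i := fun i => (ha i).le.trans (hy i trivial).1
    rw [← Finset.mul_sum, ← Finset.sum_mul, ← mul_add, ← ENNReal.ofReal_sum_of_nonneg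
      fun i _ => div_nonneg (hy0 i) hr.le, ← Finset.sum_div,
      stickDensity_split hr (Finset.sum_nonneg fun i _ => hy0 i)]
  · exact Finset.measurable_fun_sum _ fun j _ => hF j

theorem intensityIntegral_eq_zero {a b : Fin (k + 1) → ℝ} (ha : ∀ i, 0 < a i) {r : ℝ}
    (hr : r < a 0) : intensityIntegral θ a b r = 0 := by
  rw [intensityIntegral, ← lintegral_zero (μ := volume.restrict
    (univ.pi fun i => Icc (a i) (b i)))]
  refine setLIntegral_congr_fun (measurableSet_pi_Icc a b) fun y hy => ?_
  have : a 0 ≤ ∑ i, y i := (hy 0 trivial).1.trans (Finset.single_le_sum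
    (fun i _ => (ha i).le.trans (hy i trivial).1) (Finset.mem_univ 0))
  simp only [stickDensity]
  rw [if_neg (by linarith), mul_zero]

/-- After averaging the power is `θ > 0` of a ratio at most 1, so the bound is uniform in `r` even
for `θ < 1`. -/
theorem stickOp_intensityIntegral_le (hθ : 0 < θ) {a b : Fin k → ℝ} (ha : ∀ i, 0 < a i) :
    ∃ C : ℝ≥0∞, C ≠ ∞ ∧ ∀ r : ℝ, 0 < r → stickOp θ (intensityIntegral θ a b) r ≤ C := by
  refine ⟨(∏ i, ENNReal.ofReal (θ / a i)) * volume (univ.pi fun i => Icc (a i) (b i)), ?_,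
    fun r hr => ?_⟩
  · refine ENNReal.mul_ne_top (ENNReal.prod_ne_top fun i _ => by simp) ?_
    rw [volume_pi_pi]
    exact ENNReal.prod_ne_top fun i _ => by simp
  · rw [stickOp_intensityIntegral hθ ha hr, ← setLIntegral_const]
    refine setLIntegral_mono' (measurableSet_pi_Icc a b) fun y hy => ?_
    have hy0 : 0 ≤ ∑ i, y i := Finset.sum_nonneg fun i _ => (ha i).le.trans (hy i trivial).1
    have h1 : (if ∑ i, y i < r then ENNReal.ofReal (((r - ∑ i, y i) / r) ^ θ) else 0) ≤ 1 := by
      split_ifs with h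
      · refine ENNReal.ofReal_le_one.2 (Real.rpow_le_one (div_nonneg (by linarith) hr.le) ?_ hθ.le)
        exact (div_le_one hr).2 (by linarith)
      · exact zero_le_one
    calc _ ≤ (∏ i, ENNReal.ofReal (θ / y i)) * 1 := by gcongr
      _ ≤ _ := by
        rw [mul_one]
        refine Finset.prod_le_prod' fun i _ => ENNReal.ofReal_le_ofReal ?_
        have := ha i
        have := (hy i trivial).1
        gcongr

theorem intensityIntegral_one {a b : Fin k → ℝ} (hθ : 0 < θ) (ha : ∀ i, 0 < a i) :
    intensityIntegral θ a b 1 = ∫⁻ y in univ.pi fun i => Icc (a i) (b i), pdDensity θ k y := by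
  refine setLIntegral_congr_fun (measurableSet_pi_Icc a b) fun y hy => ?_
  have hy0 : ∀ i, 0 < y i := fun i => (ha i).trans_le (hy i trivial).1
  simp only [stickDensity, pdDensity]
  split_ifs with h
  · rw [← ENNReal.ofReal_prod_of_nonneg fun i _ => (div_pos hθ (hy0 i)).le,
      ← ENNReal.ofReal_mul (Finset.prod_nonneg fun i _ => (div_pos hθ (hy0 i)).le), div_one,
      Finset.prod_div_distrib, Finset.prod_const, Finset.card_univ, Fintype.card_fin]
    congr 1
    ring
  · simp

end StickDensity

/-! ### Mean counts of the stick-breaking sequence equal the intensity integral. -/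

section GemCount

open Filter Topology

variable {θ : ℝ} {k : ℕ}

/-- The number of terms of the stick-breaking sequence, scaled by `r`, that lie in `S`. -/
noncomputable def gemCount (θ : ℝ) (S : Set ℝ) (r : ℝ) (u : ℕ → ℝ) : ℝ≥0∞ :=
  ∑' n, S.indicator 1 (r * gem θ u n)

theorem measurable_gemCount (θ : ℝ) {S : Set ℝ} (hS : MeasurableSet S) :
    Measurable fun p : ℝ × (ℕ → ℝ) => gemCount θ S p.1 p.2 := by
  refine Measurable.tsum fun n => ?_
  have h1 : Measurable fun p : ℝ × (ℕ → ℝ) => p.1 * gem θ p.2 n := by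
    have : Measurable fun p : ℝ × (ℕ → ℝ) => gem θ p.2 n :=
      (measurable_pi_apply n).comp ((measurable_gem θ).comp measurable_snd)
    fun_prop
  exact (measurable_const.indicator hS).comp h1

theorem gemCount_cons (θ : ℝ) (S : Set ℝ) (r x : ℝ) (u : ℕ → ℝ) :
    gemCount θ S r (fun n => Nat.casesOn (motive := fun _ => ℝ) n x u)
      = S.indicator 1 (r - r * x ^ (1 / θ)) + gemCount θ S (r * x ^ (1 / θ)) u := by
  rw [gemCount, tsum_eq_zero_add' ENNReal.summable, gem_zero, gemCount, mul_sub, mul_one]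
  simp only [gem_succ, mul_assoc]
  rfl

theorem lintegral_iidUniform_eq {F : (ℕ → ℝ) → ℝ≥0∞} (hF : Measurable F) :
    ∫⁻ u, F u ∂iidUniform = ∫⁻ x in Ioo 0 1, ∫⁻ u,
      F (fun n => Nat.casesOn (motive := fun _ => ℝ) n x u) ∂iidUniform := by
  have hm : Measurable (fun (p : ℝ × (ℕ → ℝ)) (n : ℕ) =>
      (Nat.casesOn (motive := fun _ => ℝ) n p.1 p.2 : ℝ)) := by
    refine measurable_pi_lambda _ fun n => ?_
    cases n with
    | zero => exact measurable_fst
    | succ n => exact (measurable_pi_apply n).comp measurable_snd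
  conv_lhs => rw [← map_cons_iidUniform]
  rw [lintegral_map hF hm]
  exact lintegral_prod _ (show Measurable fun p : ℝ × (ℕ → ℝ) =>
    F fun n => Nat.casesOn (motive := fun _ => ℝ) n p.1 p.2 from hF.comp hm).aemeasurable

/-- The first piece lies in at most one of the disjoint intervals, so the expansion of the product
stops at first order. -/
theorem prod_add_of_subsingleton {x y : Fin (k + 1) → ℝ≥0∞}
    (h : ∀ i j, x i ≠ 0 → x j ≠ 0 → i = j) :
    ∏ i, (x i + y i) = ∏ i, y i + ∑ j, x j * ∏ i, y (j.succAbove i) := by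
  by_cases hx : ∀ i, x i = 0
  · simp [hx]
  · push Not at hx
    obtain ⟨j, hj⟩ := hx
    have h0 : ∀ i, i ≠ j → x i = 0 := fun i hi => by
      by_contra hc
      exact hi (h i j hc hj)
    rw [Finset.sum_eq_single j (fun i _ hi => by rw [h0 i hi, zero_mul]) (by simp),
      Fin.prod_univ_succAbove _ j, Fin.prod_univ_succAbove y j, add_mul]
    simp only [h0 _ (Fin.succAbove_ne j _), zero_add]
    ring

/-- `𝔼 (N(I_1) ⋯ N(I_k))`, where `N(I)` counts the terms in `I` of the stick-breaking sequence
scaled by `r`. -/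
noncomputable def gemMean (θ : ℝ) {k : ℕ} (a b : Fin k → ℝ) (r : ℝ) : ℝ≥0∞ :=
  ∫⁻ u, ∏ i, gemCount θ (Icc (a i) (b i)) r u ∂iidUniform

theorem measurable_prod_gemCount (θ : ℝ) (a b : Fin k → ℝ) :
    Measurable fun p : ℝ × (ℕ → ℝ) => ∏ i, gemCount θ (Icc (a i) (b i)) p.1 p.2 :=
  Finset.measurable_fun_prod _ fun _ _ => measurable_gemCount θ measurableSet_Icc

theorem measurable_gemMean (a b : Fin k → ℝ) : Measurable (gemMean θ a b) :=
  (measurable_prod_gemCount θ a b).lintegral_prod_right'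

theorem measurable_prod_gemCount_right (a b : Fin k → ℝ) (r : ℝ) :
    Measurable fun u => ∏ i, gemCount θ (Icc (a i) (b i)) r u :=
  (measurable_prod_gemCount θ a b).comp (f := fun u => (r, u)) measurable_prodMk_left

theorem gemMean_renewal (hθ : 0 < θ) {a b : Fin (k + 1) → ℝ}
    (hd : Pairwise fun i j => Disjoint (Icc (a i) (b i)) (Icc (a j) (b j))) {r : ℝ} (hr : 0 < r) :
    gemMean θ a b r = stickOp θ (gemMean θ a b) r
      + ∑ j, stickOp θ (fun w => (Icc (a j) (b j)).indicator 1 (r - w) *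
        gemMean θ (a ∘ j.succAbove) (b ∘ j.succAbove) w) r := by
  have hind : ∀ j, Measurable fun w => (Icc (a j) (b j)).indicator (1 : ℝ → ℝ≥0∞) (r - w) :=
    fun j => (measurable_one.indicator measurableSet_Icc).comp (by fun_prop)
  have hM : ∀ j : Fin (k + 1), Measurable fun w => (Icc (a j) (b j)).indicator 1 (r - w) *
      gemMean θ (a ∘ j.succAbove) (b ∘ j.succAbove) w := fun j =>
    (hind j).mul (measurable_gemMean _ _)
  have hstep : ∀ w, ∫⁻ u, ∏ i, ((Icc (a i) (b i)).indicator 1 (r - w)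
      + gemCount θ (Icc (a i) (b i)) w u) ∂iidUniform = gemMean θ a b w
      + ∑ j, (Icc (a j) (b j)).indicator 1 (r - w) *
        gemMean θ (a ∘ j.succAbove) (b ∘ j.succAbove) w := by
    intro w
    have h1 : ∀ u, ∏ i, ((Icc (a i) (b i)).indicator 1 (r - w)
      + gemCount θ (Icc (a i) (b i)) w u) = ∏ i, gemCount θ (Icc (a i) (b i)) w u
      + ∑ j, (Icc (a j) (b j)).indicator 1 (r - w) *
        ∏ i, gemCount θ (Icc ((a ∘ j.succAbove) i) ((b ∘ j.succAbove) i)) w u := by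
      intro u
      refine prod_add_of_subsingleton (y := fun i => gemCount θ (Icc (a i) (b i)) w u)
        fun i j hi hj => ?_
      by_contra hij
      exact disjoint_left.1 (hd hij) (mem_of_indicator_ne_zero hi) (mem_of_indicator_ne_zero hj)
    simp_rw [h1]
    rw [lintegral_add_left (measurable_prod_gemCount_right a b w), lintegral_finsetSum]
    · simp_rw [lintegral_const_mul _ (measurable_prod_gemCount_right (θ := θ) _ _ w)]
      rfl
    · exact fun j _ => (measurable_prod_gemCount_right _ _ w).const_mul _
  rw [gemMean, lintegral_iidUniform_eq (measurable_prod_gemCount_right a b r)]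
  refine (lintegral_congr fun x => lintegral_congr fun u =>
    Finset.prod_congr rfl fun i _ => gemCount_cons θ _ r x u).trans ?_
  rw [lintegral_uniform_eq_stickOp hθ hr fun w => ∫⁻ u, ∏ i, ((Icc (a i) (b i)).indicator 1 (r - w)
      + gemCount θ (Icc (a i) (b i)) w u) ∂iidUniform]
  simp_rw [hstep]
  rw [stickOp_add (measurable_gemMean a b), stickOp_finset_sum _ hM]

theorem gemCount_le (hθ : 0 < θ) {u : ℕ → ℝ} (hu : ∀ i, u i ∈ Ioo (0 : ℝ) 1) {a b : ℝ}
    (ha : 0 < a) {r : ℝ} (hr : r ≤ 1) : gemCount θ (Icc a b) r u ≤ ENNReal.ofReal (1 / a) := by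
  calc gemCount θ (Icc a b) r u
      ≤ ∑' n, ENNReal.ofReal (1 / a) * ENNReal.ofReal (gem θ u n) := by
        refine ENNReal.tsum_le_tsum fun n => ?_
        by_cases h : r * gem θ u n ∈ Icc a b
        · have h1 := gem_pos hθ hu n
          have h2 := h.1
          rw [indicator_of_mem h, ← ENNReal.ofReal_mul (by positivity), Pi.one_apply,
            ENNReal.one_le_ofReal, one_div, le_inv_mul_iff₀ ha]
          nlinarith
        · simp [indicator_of_notMem h]
    _ ≤ ENNReal.ofReal (1 / a) := by
        rw [ENNReal.tsum_mul_left]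
        exact mul_le_of_le_one_right' (tsum_ofReal_gem_le_one hθ hu)

theorem gemMean_le (hθ : 0 < θ) {a b : Fin k → ℝ} (ha : ∀ i, 0 < a i) {r : ℝ} (hr : r ≤ 1) :
    gemMean θ a b r ≤ ∏ i, ENNReal.ofReal (1 / a i) := by
  refine (lintegral_mono_ae ?_).trans_eq (by rw [lintegral_const, measure_univ, mul_one])
  filter_upwards [ae_iidUniform_mem_Ioo] with u hu
  exact Finset.prod_le_prod' fun i _ => gemCount_le hθ hu (ha i) hr

theorem gemMean_eq_zero (hθ : 0 < θ) {a b : Fin (k + 1) → ℝ} (ha : ∀ i, 0 < a i) {r : ℝ}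
    (hr : r < a 0) : gemMean θ a b r = 0 := by
  rw [gemMean, ← lintegral_zero (μ := iidUniform)]
  refine lintegral_congr_ae ?_
  filter_upwards [ae_iidUniform_mem_Ioo] with u hu
  refine Finset.prod_eq_zero (Finset.mem_univ 0) ?_
  rw [gemCount, ENNReal.tsum_eq_zero]
  intro n
  refine indicator_of_notMem (fun h => ?_) _
  have h1 := gem_pos hθ hu n
  have h2 := gem_le_one hθ hu n
  have h3 := h.1
  have h4 := ha 0
  nlinarith

/-- Both sides solve the same renewal equation, whose inhomogeneous term involves only order `k`
intensities, equal by induction. All scales `r` are needed because the equation couples them. -/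
theorem gemMean_eq_intensityIntegral (hθ : 0 < θ) : ∀ (k : ℕ) (a b : Fin k → ℝ),
    (∀ i, 0 < a i) → (Pairwise fun i j => Disjoint (Icc (a i) (b i)) (Icc (a j) (b j))) →
    ∀ r ∈ Ioc (0 : ℝ) 1, gemMean θ a b r = intensityIntegral θ a b r := by
  intro k
  induction k with
  | zero =>
    intro a b _ _ r hr
    have h : Icc a b = univ := Subsingleton.eq_univ_of_nonempty ⟨a, le_rfl, fun i => i.elim0⟩
    simp [gemMean, intensityIntegral, stickDensity, hr.1, hr.1.ne', volume_pi, h]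
  | succ k ih =>
    intro a b ha hd r hr
    obtain ⟨C, hC, hC'⟩ := stickOp_intensityIntegral_le (b := b) hθ ha
    refine eq_of_renewal hθ (measurable_gemMean a b) (measurable_intensityIntegral a b)
      (c := fun r => ∑ j, stickOp θ (fun w => (Icc (a j) (b j)).indicator 1 (r - w) *
        gemMean θ (a ∘ j.succAbove) (b ∘ j.succAbove) w) r)
      (fun r hr => gemMean_renewal hθ hd hr.1) (fun r hr => ?_) (ha 0)
      (fun r hr => gemMean_eq_zero hθ ha hr) (fun r hr => intensityIntegral_eq_zero ha hr)
      (C := ∏ i, ENNReal.ofReal (1 / a i)) (ENNReal.prod_ne_top fun i _ => by simp) hC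
      (fun r hr => ?_) (fun r hr => hC' r hr.1) hr
    · rw [intensityIntegral_renewal hθ ha hr.1]
      congr 1
      refine Finset.sum_congr rfl fun j _ => stickOp_congr fun w hw => ?_
      rw [ih (a ∘ j.succAbove) (b ∘ j.succAbove) (fun i => ha _) (fun i i' h => hd fun h' => h (Fin.succAbove_right_injective h'))
        w ⟨hw.1, hw.2.le.trans hr.2⟩]
    · refine le_trans ?_ (gemMean_le (b := b) hθ ha hr.2)
      rw [gemMean_renewal hθ hd hr.1]
      exact le_self_add

theorem hasMultiIntensityDensity_poissonDirichletMultiset (hθ : 0 < θ) (k : ℕ) :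
    HasMultiIntensityDensity (poissonDirichletMultiset θ) id k (pdDensity θ k) := by
  intro a b hab hd
  have hm : Measurable fun A : UnitMultiset => ∏ i, A.count (Icc (a i) (b i)) :=
    Finset.measurable_fun_prod _ fun i _ => UnitMultiset.measurable_count measurableSet_Icc
  rw [← intensityIntegral_one hθ fun i => (hab i).1,
    ← gemMean_eq_intensityIntegral hθ k a b (fun i => (hab i).1) hd 1 ⟨one_pos, le_rfl⟩,
    poissonDirichletMultiset_eq hθ]
  simp only [id]
  rw [lintegral_map hm (measurable_ofSeq_gem θ), gemMean]
  refine lintegral_congr_ae ?_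
  filter_upwards [ae_iidUniform_mem_Ioo] with u hu
  simp only [count_ofSeq_gem hθ hu measurableSet_Icc, gemCount, one_mul]

end GemCount

/-! ### From closed intervals to disjoint dyadic cells. -/

section Cells

open Filter Topology

namespace UnitMultiset

theorem exists_count_eq_natCast (A : UnitMultiset) {S : Set ℝ} (h : A.count S ≠ ∞) :
    ∃ m : ℕ, A.count S = m := by
  have hfin := ENNReal.finite_const_le_of_tsum_ne_top h one_ne_zero
  refine ⟨∑ x ∈ hfin.toFinset, A.mult x, ?_⟩
  rw [count, tsum_eq_sum (s := hfin.toFinset)]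
  · simp
  · intro x hx
    simpa [Nat.one_le_iff_ne_zero] using hx

theorem mult_le_count (A : UnitMultiset) {S : Set ℝ} {x : ℝ} (hx : x ∈ S) :
    (A.mult x : ℝ≥0∞) ≤ A.count S :=
  ENNReal.le_tsum (f := fun x : S => (A.mult x : ℝ≥0∞)) ⟨x, hx⟩

end UnitMultiset

theorem Ioc_eq_iUnion_Icc_add_div {a b : ℝ} (hab : a < b) :
    Ioc a b = ⋃ n : ℕ, Icc (a + (b - a) / (n + 2)) b := by
  ext x
  simp only [mem_Ioc, mem_iUnion, mem_Icc]
  constructor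
  · rintro ⟨h1, h2⟩
    obtain ⟨n, hn⟩ := exists_nat_gt ((b - a) / (x - a))
    refine ⟨n, ?_, h2⟩
    rw [div_lt_iff₀ (by linarith)] at hn
    have : (b - a) / (n + 2) ≤ x - a := by
      rw [div_le_iff₀ (by positivity)]
      nlinarith
    linarith
  · rintro ⟨n, h1, h2⟩
    refine ⟨?_, h2⟩
    by_contra hc
    have : 0 < (b - a) / (n + 2) := div_pos (by linarith) (by positivity)
    linarith

/-- Adjacent dyadic intervals share endpoints when closed, so the hypothesis is transferred to
half-open ones by monotone exhaustion. The bound on the sum keeps counts finite, so that limits pass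
through the product. -/
theorem lintegral_prod_count_Ioc {Q : Measure UnitMultiset} (hQ : ∀ᵐ A ∂Q, A.sum ≤ 1) {k : ℕ}
    {f : (Fin k → ℝ) → ℝ≥0∞} (h : HasMultiIntensityDensity Q id k f) {a b : Fin k → ℝ}
    (hab : ∀ i, 0 < a i ∧ a i < b i ∧ b i ≤ 1)
    (hd : Pairwise fun i j => Disjoint (Ioc (a i) (b i)) (Ioc (a j) (b j))) :
    ∫⁻ A, ∏ i, A.count (Ioc (a i) (b i)) ∂Q
      = ∫⁻ x in univ.pi fun i => Ioc (a i) (b i), f x := by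
  set c : ℕ → Fin k → ℝ := fun n i => a i + (b i - a i) / (n + 2) with hc
  have hpos : ∀ (n : ℕ) i, 0 < (b i - a i) / ((n : ℝ) + 2) := fun n i =>
    div_pos (by linarith [(hab i).2.1]) (by positivity)
  have hcb : ∀ n i, c n i < b i := fun n i => by
    have h1 : (b i - a i) / ((n : ℝ) + 2) < b i - a i :=
      div_lt_self (by linarith [(hab i).2.1]) (by linarith [n.cast_nonneg (α := ℝ)])
    simp only [hc]; linarith
  have hanti : ∀ i, Antitone fun n => c n i := fun i m n hmn => by
    have := sub_pos.2 (hab i).2.1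
    have h2 : (m : ℝ) ≤ n := by exact_mod_cast hmn
    have h3 : (b i - a i) / ((n : ℝ) + 2) ≤ (b i - a i) / ((m : ℝ) + 2) :=
      div_le_div_of_nonneg_left this.le (by positivity) (by linarith)
    simp only [hc]
    linarith
  have hmono : ∀ i, Monotone fun n => Icc (c n i) (b i) := fun i m n hmn =>
    Icc_subset_Icc_left (hanti i hmn)
  have hU : ∀ i, ⋃ n, Icc (c n i) (b i) = Ioc (a i) (b i) := fun i =>
    (Ioc_eq_iUnion_Icc_add_div (hab i).2.1).symm
  have hsub : ∀ n i, Icc (c n i) (b i) ⊆ Ioc (a i) (b i) := fun n i => by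
    rw [← hU i]; exact subset_iUnion (fun n => Icc (c n i) (b i)) n
  have h1 : ∀ n, ∫⁻ A, ∏ i, A.count (Icc (c n i) (b i)) ∂Q
      = ∫⁻ x in univ.pi fun i => Icc (c n i) (b i), f x := fun n =>
    h (c n) b (fun i => ⟨by linarith [(hab i).1, hpos n i, show c n i = _ from rfl],
      hcb n i, (hab i).2.2⟩) fun i j hij => (hd hij).mono (hsub n i) (hsub n j)
  have hl : Tendsto (fun n => ∫⁻ A, ∏ i, A.count (Icc (c n i) (b i)) ∂Q) atTop
      (𝓝 (∫⁻ A, ∏ i, A.count (Ioc (a i) (b i)) ∂Q)) := by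
    refine lintegral_tendsto_of_tendsto_of_monotone
      (fun n => (Finset.measurable_fun_prod _ fun i _ =>
        UnitMultiset.measurable_count measurableSet_Icc).aemeasurable) ?_ ?_
    · refine Eventually.of_forall fun A m n hmn => Finset.prod_le_prod' fun i _ => ?_
      rw [← A.toMeasure_apply measurableSet_Icc, ← A.toMeasure_apply measurableSet_Icc]
      exact measure_mono (hmono i hmn)
    · filter_upwards [hQ] with A hA
      refine ENNReal.tendsto_finsetProd_of_ne_top _ (fun i _ => ?_) fun i _ => ?_
      · rw [← A.toMeasure_apply measurableSet_Ioc, ← hU i]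
        simp_rw [← A.toMeasure_apply measurableSet_Icc]
        exact tendsto_measure_iUnion_atTop (hmono i)
      · exact (A.count_lt_top hA (hab i).1 measurableSet_Ioc fun x hx => hx.1.le).ne
  have hr : Tendsto (fun n => ∫⁻ x in univ.pi fun i => Icc (c n i) (b i), f x) atTop
      (𝓝 (∫⁻ x in univ.pi fun i => Ioc (a i) (b i), f x)) := by
    have hU' : (univ.pi fun i => Ioc (a i) (b i)) = ⋃ n, univ.pi fun i => Icc (c n i) (b i) := by
      rw [iUnion_univ_pi_of_monotone hmono]
      simp_rw [hU]
    rw [hU', ← withDensity_apply' f]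
    simp_rw [← withDensity_apply' f]
    exact tendsto_measure_iUnion_atTop fun m n hmn => pi_mono fun i _ => hmono i hmn
  simp_rw [h1] at hl
  exact tendsto_nhds_unique hl hr

/-- The dyadic interval `((j-1)/2^n, j/2^n]`. -/
def dyadicCell (n j : ℕ) : Set ℝ := Ioc (((j : ℝ) - 1) / 2 ^ n) (j / 2 ^ n)

theorem mem_dyadicCell {n j : ℕ} {x : ℝ} : x ∈ dyadicCell n j ↔ ⌈2 ^ n * x⌉ = (j : ℤ) := by
  rw [Int.ceil_eq_iff, dyadicCell, mem_Ioc, div_lt_iff₀' (by positivity),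
    le_div_iff₀' (by positivity)]
  simp

theorem measurableSet_dyadicCell (n j : ℕ) : MeasurableSet (dyadicCell n j) := measurableSet_Ioc

theorem disjoint_dyadicCell (n : ℕ) {i j : ℕ} (h : i ≠ j) :
    Disjoint (dyadicCell n i) (dyadicCell n j) := by
  rw [disjoint_left]
  intro x hi hj
  rw [mem_dyadicCell] at hi hj
  exact h (by exact_mod_cast hi.symm.trans hj)

/-- The left end of a dyadic interval. -/
noncomputable def cellLeft (n j : ℕ) : ℝ := ((j : ℝ) - 1) / 2 ^ n

/-- Index 1 is excluded throughout: its cell reaches down to 0, where the intensity hypothesis and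
the count bound say nothing. -/
theorem cellLeft_pos (n : ℕ) {j : ℕ} (hj : 2 ≤ j) : 0 < cellLeft n j := by
  have : (2 : ℝ) ≤ j := by exact_mod_cast hj
  exact div_pos (by linarith) (by positivity)

theorem cellLeft_lt {n j : ℕ} {x : ℝ} (hx : x ∈ dyadicCell n j) : cellLeft n j < x := hx.1

theorem lt_cellLeft_add {n j : ℕ} {x : ℝ} (hx : x ∈ dyadicCell n j) :
    x ≤ cellLeft n j + 1 / 2 ^ n := by
  have := hx.2
  rw [cellLeft, ← add_div]
  simpa using this

theorem dyadicCell_subset {n j : ℕ} (hj : j ∈ Finset.Icc 2 (2 ^ n)) :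
    dyadicCell n j ⊆ Ioc 0 1 := by
  rw [Finset.mem_Icc] at hj
  intro x hx
  refine ⟨(cellLeft_pos n hj.1).trans hx.1, hx.2.trans ?_⟩
  rw [div_le_one (by positivity)]
  exact_mod_cast hj.2

theorem exists_mem_dyadicCell {n : ℕ} {x : ℝ} (hx : x ∈ Ioc (0 : ℝ) 1) (hn : 1 < 2 ^ n * x) :
    ∃ j ∈ Finset.Icc 2 (2 ^ n), x ∈ dyadicCell n j := by
  have h1 : 1 < ⌈2 ^ n * x⌉ := by rw [Int.lt_ceil]; exact_mod_cast hn
  have h2 : ⌈2 ^ n * x⌉ ≤ 2 ^ n := by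
    rw [Int.ceil_le]
    push_cast
    nlinarith [hx.2, show (0 : ℝ) < 2 ^ n by positivity]
  obtain ⟨j, hj⟩ := Int.eq_ofNat_of_zero_le (show 0 ≤ ⌈2 ^ n * x⌉ by omega)
  refine ⟨j, ?_, mem_dyadicCell.2 hj⟩
  rw [hj] at h1 h2
  rw [Finset.mem_Icc]
  exact ⟨by omega, by exact_mod_cast h2⟩

theorem tendsto_two_pow_mul_atTop {x : ℝ} (hx : 0 < x) :
    Tendsto (fun n : ℕ => 2 ^ n * x) atTop atTop :=
  (tendsto_pow_atTop_atTop_of_one_lt one_lt_two).atTop_mul_const hx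

theorem lintegral_prod_count_dyadicCell {Q : Measure UnitMultiset} (hQ : ∀ᵐ A ∂Q, A.sum ≤ 1)
    {k : ℕ} {f : (Fin k → ℝ) → ℝ≥0∞} (h : HasMultiIntensityDensity Q id k f) (n : ℕ)
    {e : Fin k → ℕ} (he : Function.Injective e) (he' : ∀ i, e i ∈ Finset.Icc 2 (2 ^ n)) :
    ∫⁻ A, ∏ i, A.count (dyadicCell n (e i)) ∂Q
      = ∫⁻ x in univ.pi fun i => dyadicCell n (e i), f x := by
  refine lintegral_prod_count_Ioc hQ h (fun i => ⟨cellLeft_pos n (Finset.mem_Icc.1 (he' i)).1,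
    ?_, ?_⟩) fun i j hij => disjoint_dyadicCell n (he.ne hij)
  · gcongr
    linarith
  · rw [div_le_one (by positivity)]
    exact_mod_cast (Finset.mem_Icc.1 (he' i)).2

end Cells

/-! ### Second moments computed from the densities of order 1 and 2. -/

section SecondMoment

open Filter Topology

variable {θ : ℝ}

theorem measurable_pdDensity (θ : ℝ) (k : ℕ) : Measurable (pdDensity θ k) := by
  unfold pdDensity
  exact Measurable.ite (measurableSet_lt (by fun_prop) measurable_const) (by fun_prop)
    measurable_const

/-- Turns Riemann-type sums into integrals against step functions, ready for dominated convergence.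
-/
theorem sum_mul_setLIntegral {α ι : Type*} [MeasurableSpace α] {μ : Measure α} (T : Finset ι)
    (c : ι → ℝ≥0∞) {S : ι → Set α} (hS : ∀ i, MeasurableSet (S i)) {f : α → ℝ≥0∞}
    (hf : Measurable f) : ∑ i ∈ T, c i * ∫⁻ x in S i, f x ∂μ
      = ∫⁻ x, (∑ i ∈ T, (S i).indicator (fun _ => c i) x) * f x ∂μ := by
  simp_rw [Finset.sum_mul]
  have hm : ∀ i, Measurable fun x => (S i).indicator (fun _ => c i) x * f x := fun i =>
    (measurable_const.indicator (hS i)).mul hf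
  rw [lintegral_finsetSum _ fun i _ => hm i]
  refine Finset.sum_congr rfl fun i _ => ?_
  rw [← lintegral_const_mul _ hf, ← lintegral_indicator (hS i)]
  refine lintegral_congr fun x => ?_
  by_cases h : x ∈ S i <;> simp [h]

theorem sum_mul_sum_eq_add_offDiag {ι R : Type*} [DecidableEq ι] [CommSemiring R] (s : Finset ι)
    (x y : ι → R) :
    (∑ i ∈ s, x i) * ∑ i ∈ s, y i = ∑ i ∈ s, x i * y i + ∑ p ∈ s.offDiag, x p.1 * y p.2 := by
  rw [Finset.sum_mul_sum, ← Finset.sum_product', ← Finset.diag_union_offDiag,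
    Finset.sum_union (Finset.disjoint_diag_offDiag s), Finset.sum_diag]

/-- The indices of the dyadic intervals of length `2^(-n)` in `(2^(-n), 1]`. -/
abbrev cellIndices (n : ℕ) : Finset ℕ := Finset.Icc 2 (2 ^ n)

/-- The left end of the dyadic interval containing `x`, or `0` if `x ∉ (2^(-n), 1]`. -/
noncomputable def dyadicLower (n : ℕ) (x : ℝ) : ℝ≥0∞ :=
  ∑ j ∈ cellIndices n, (dyadicCell n j).indicator (fun _ => ENNReal.ofReal (cellLeft n j)) x

theorem dyadicLower_of_mem {n j : ℕ} (hj : j ∈ cellIndices n) {x : ℝ} (hx : x ∈ dyadicCell n j) :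
    dyadicLower n x = ENNReal.ofReal (cellLeft n j) := by
  rw [dyadicLower, Finset.sum_eq_single j, indicator_of_mem hx]
  · intro i _ hi
    exact indicator_of_notMem (fun h => disjoint_left.1 (disjoint_dyadicCell n hi) h hx) _
  · exact fun h => absurd hj h

theorem dyadicLower_le (n : ℕ) (x : ℝ) :
    dyadicLower n x ≤ (Ioc 0 1).indicator ENNReal.ofReal x := by
  by_cases h : ∃ j ∈ cellIndices n, x ∈ dyadicCell n j
  · obtain ⟨j, hj, hx⟩ := h
    rw [dyadicLower_of_mem hj hx, indicator_of_mem (dyadicCell_subset hj hx)]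
    exact ENNReal.ofReal_le_ofReal (cellLeft_lt hx).le
  · push Not at h
    rw [dyadicLower, Finset.sum_eq_zero fun j hj => indicator_of_notMem (h j hj) _]
    exact zero_le

theorem tendsto_dyadicLower (x : ℝ) :
    Tendsto (fun n => dyadicLower n x) atTop (𝓝 ((Ioc 0 1).indicator ENNReal.ofReal x)) := by
  by_cases hx : x ∈ Ioc 0 1
  · refine tendsto_of_tendsto_of_tendsto_of_le_of_le' (g := fun n : ℕ =>
      ENNReal.ofReal (x - (1 / 2) ^ n)) ?_ tendsto_const_nhds ?_
      (Eventually.of_forall fun n => dyadicLower_le n x)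
    · rw [indicator_of_mem hx]
      refine ENNReal.tendsto_ofReal ?_
      have := (tendsto_pow_atTop_nhds_zero_of_lt_one (r := (1 / 2 : ℝ)) (by norm_num)
        (by norm_num)).const_sub x
      simpa using this
    · filter_upwards [(tendsto_two_pow_mul_atTop hx.1).eventually_gt_atTop 1] with n hn
      obtain ⟨j, hj, hxj⟩ := exists_mem_dyadicCell hx hn
      rw [dyadicLower_of_mem hj hxj]
      refine ENNReal.ofReal_le_ofReal ?_
      have := lt_cellLeft_add hxj
      rw [one_div_pow]
      linarith
  · have : ∀ n, dyadicLower n x = 0 := fun n => by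
      have := dyadicLower_le n x
      rw [indicator_of_notMem hx] at this
      exact le_antisymm this zero_le
    simp [this, hx]

theorem tendsto_sum_sq_setLIntegral {f : (Fin 1 → ℝ) → ℝ≥0∞} (hf : Measurable f)
    (hft : ∀ x, f x ≠ ∞)
    (hfin : ∫⁻ x, ((Ioc 0 1).indicator ENNReal.ofReal (x 0)) ^ 2 * f x ≠ ∞) :
    Tendsto (fun n => ∑ j ∈ cellIndices n, ENNReal.ofReal (cellLeft n j) ^ 2 *
      ∫⁻ x in univ.pi fun _ => dyadicCell n j, f x) atTop
      (𝓝 (∫⁻ x, ((Ioc 0 1).indicator ENNReal.ofReal (x 0)) ^ 2 * f x)) := by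
  have hS : ∀ n j, MeasurableSet (univ.pi fun _ : Fin 1 => dyadicCell n j) := fun n j =>
    .univ_pi fun _ => measurableSet_dyadicCell n j
  have hW : ∀ n (x : Fin 1 → ℝ), ∑ j ∈ cellIndices n, (univ.pi fun _ : Fin 1 =>
      dyadicCell n j).indicator (fun _ => ENNReal.ofReal (cellLeft n j) ^ 2) x
      = dyadicLower n (x 0) ^ 2 := by
    intro n x
    have hmem : ∀ j, x ∈ (univ.pi fun _ : Fin 1 => dyadicCell n j) ↔ x 0 ∈ dyadicCell n j :=
      fun j => by simp [Fin.forall_fin_one]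
    by_cases h : ∃ j ∈ cellIndices n, x 0 ∈ dyadicCell n j
    · obtain ⟨j, hj, hx⟩ := h
      rw [dyadicLower_of_mem hj hx, Finset.sum_eq_single j, indicator_of_mem ((hmem j).2 hx)]
      · intro i _ hi
        exact indicator_of_notMem (fun h => disjoint_left.1 (disjoint_dyadicCell n hi)
          ((hmem i).1 h) hx) _
      · exact fun h => absurd hj h
    · push Not at h
      rw [dyadicLower, Finset.sum_eq_zero fun j hj => indicator_of_notMem (h j hj) _,
        Finset.sum_eq_zero fun j hj => indicator_of_notMem (fun h' => h j hj ((hmem j).1 h')) _]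
      simp
  simp_rw [sum_mul_setLIntegral (cellIndices _) _ (hS _) hf, hW]
  refine tendsto_lintegral_of_dominated_convergence _ (fun n => ?_) (fun n => ?_) hfin ?_
  · simp_rw [← hW]
    exact (Finset.measurable_fun_sum _ fun j _ => measurable_const.indicator (hS n j)).mul hf
  · refine Eventually.of_forall fun x => ?_
    have := dyadicLower_le n (x 0)
    dsimp only
    gcongr
  · refine Eventually.of_forall fun x => ENNReal.Tendsto.mul_const ?_ (Or.inr (hft x))
    exact ((ENNReal.continuous_pow 2).tendsto _).comp (tendsto_dyadicLower (x 0))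

theorem ae_ne_fin_two : ∀ᵐ x : Fin 2 → ℝ, x 0 ≠ x 1 := by
  have h : ∀ᵐ p : ℝ × ℝ, p.1 ≠ p.2 := by
    have hm : MeasurableSet {p : ℝ × ℝ | p.1 = p.2} := measurableSet_eq_fun measurable_fst
      measurable_snd
    have : volume {p : ℝ × ℝ | p.1 = p.2} = 0 := by
      rw [Measure.volume_eq_prod, Measure.measure_prod_null hm]
      refine Eventually.of_forall fun x => ?_
      have : Prod.mk x ⁻¹' {p : ℝ × ℝ | p.1 = p.2} = {x} := by
        ext y; simp [eq_comm]
      simp [this]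
    rw [ae_iff]
    simpa using this
  exact (volume_preserving_finTwoArrow ℝ).quasiMeasurePreserving.ae h

/-- The omitted diagonal cells shrink to the diagonal, which is a null set. -/
theorem tendsto_sum_offDiag_setLIntegral {f : (Fin 2 → ℝ) → ℝ≥0∞} (hf : Measurable f)
    (hft : ∀ x, f x ≠ ∞)
    (hfin : ∫⁻ x, ((Ioc 0 1).indicator ENNReal.ofReal (x 0) *
      (Ioc 0 1).indicator ENNReal.ofReal (x 1)) * f x ≠ ∞) :
    Tendsto (fun n => ∑ p ∈ (cellIndices n).offDiag,
      (ENNReal.ofReal (cellLeft n p.1) * ENNReal.ofReal (cellLeft n p.2)) *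
      ∫⁻ x in univ.pi fun i => dyadicCell n (![p.1, p.2] i), f x) atTop
      (𝓝 (∫⁻ x, ((Ioc 0 1).indicator ENNReal.ofReal (x 0) *
        (Ioc 0 1).indicator ENNReal.ofReal (x 1)) * f x)) := by
  have hS : ∀ n (p : ℕ × ℕ), MeasurableSet (univ.pi fun i => dyadicCell n (![p.1, p.2] i)) :=
    fun n p => .univ_pi fun _ => measurableSet_dyadicCell n _
  set W : ℕ → (Fin 2 → ℝ) → ℝ≥0∞ := fun n x => ∑ p ∈ (cellIndices n).offDiag,
    (univ.pi fun i => dyadicCell n (![p.1, p.2] i)).indicator (fun _ =>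
      ENNReal.ofReal (cellLeft n p.1) * ENNReal.ofReal (cellLeft n p.2)) x with hWdef
  have hWm : ∀ n, Measurable (W n) := fun n =>
    Finset.measurable_fun_sum _ fun p _ => measurable_const.indicator (hS n p)
  have hind : ∀ n (p : ℕ × ℕ) (x : Fin 2 → ℝ),
      (univ.pi fun i => dyadicCell n (![p.1, p.2] i)).indicator (fun _ =>
        ENNReal.ofReal (cellLeft n p.1) * ENNReal.ofReal (cellLeft n p.2)) x
      = (dyadicCell n p.1).indicator (fun _ => ENNReal.ofReal (cellLeft n p.1)) (x 0) *
        (dyadicCell n p.2).indicator (fun _ => ENNReal.ofReal (cellLeft n p.2)) (x 1) := by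
    intro n p x
    by_cases h0 : x 0 ∈ dyadicCell n p.1 <;> by_cases h1 : x 1 ∈ dyadicCell n p.2 <;>
      simp [indicator, Fin.forall_fin_two, h0, h1]
  have hWle : ∀ n x, W n x ≤ dyadicLower n (x 0) * dyadicLower n (x 1) := by
    intro n x
    simp only [hWdef, hind, dyadicLower]
    rw [Finset.sum_mul_sum, ← Finset.sum_product']
    exact Finset.sum_le_sum_of_subset fun p hp => by
      rw [Finset.mem_offDiag] at hp
      exact Finset.mem_product.2 ⟨hp.1, hp.2.1⟩
  simp_rw [sum_mul_setLIntegral _ _ (hS _) hf]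
  refine tendsto_lintegral_of_dominated_convergence _ (fun n => (hWm n).mul hf) (fun n => ?_)
    hfin ?_
  · refine Eventually.of_forall fun x => ?_
    refine mul_le_mul_left ((hWle n x).trans ?_) _
    exact mul_le_mul' (dyadicLower_le n _) (dyadicLower_le n _)
  · have htop : ∀ x, (Ioc 0 1).indicator ENNReal.ofReal x ≠ ∞ := fun x => by
      by_cases h : x ∈ Ioc 0 1 <;> simp [h]
    filter_upwards [ae_ne_fin_two] with x hx
    refine ENNReal.Tendsto.mul_const ?_ (Or.inr (hft x))
    refine (ENNReal.Tendsto.mul (tendsto_dyadicLower (x 0)) (Or.inr (htop _))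
      (tendsto_dyadicLower (x 1)) (Or.inr (htop _))).congr' ?_
    -- Once the cell width is below `|x 0 - x 1|`, the two coordinates lie in different cells and
    -- the diagonal terms vanish.
    filter_upwards [(tendsto_two_pow_mul_atTop (abs_pos.2 (sub_ne_zero.2 hx))).eventually_gt_atTop
      1] with n hn
    simp only [hind, dyadicLower]
    rw [sum_mul_sum_eq_add_offDiag, Finset.sum_eq_zero, zero_add]
    intro j _
    by_cases h0 : x 0 ∈ dyadicCell n j
    · have h1 : x 1 ∉ dyadicCell n j := by
        intro h1
        have e0 := lt_cellLeft_add h0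
        have e1 := lt_cellLeft_add h1
        have e2 := cellLeft_lt h0
        have e3 := cellLeft_lt h1
        have : |x 0 - x 1| ≤ 1 / 2 ^ n := by rw [abs_le]; constructor <;> linarith
        rw [le_div_iff₀ (by positivity)] at this
        linarith
      rw [indicator_of_notMem h1, mul_zero]
    · rw [indicator_of_notMem h0, zero_mul]

theorem pdDensity_ne_top (θ : ℝ) (k : ℕ) (x : Fin k → ℝ) : pdDensity θ k x ≠ ∞ := by
  unfold pdDensity
  split_ifs <;> simp

theorem lintegral_sq_mul_pdDensity_one (hθ : 0 < θ) :
    ∫⁻ x, ((Ioc 0 1).indicator ENNReal.ofReal (x 0)) ^ 2 * pdDensity θ 1 x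
      = ∫⁻ x in Ioo 0 1, ENNReal.ofReal (θ * x * (1 - x) ^ (θ - 1)) := by
  have h := (volume_preserving_funUnique (Fin 1) ℝ).lintegral_comp_emb
    (MeasurableEquiv.measurableEmbedding _) fun x => ((Ioc 0 1).indicator ENNReal.ofReal x) ^ 2 *
      if x < 1 then ENNReal.ofReal (θ * (1 - x) ^ (θ - 1) / x) else 0
  have e : ∀ x : Fin 1 → ℝ, ((Ioc 0 1).indicator ENNReal.ofReal (x 0)) ^ 2 * pdDensity θ 1 x
      = (fun x => ((Ioc 0 1).indicator ENNReal.ofReal x) ^ 2 *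
      if x < 1 then ENNReal.ofReal (θ * (1 - x) ^ (θ - 1) / x) else 0)
      (MeasurableEquiv.funUnique (Fin 1) ℝ x) := by
    intro x
    simp [pdDensity, MeasurableEquiv.funUnique]
  refine (lintegral_congr e).trans (h.trans ?_)
  rw [← lintegral_indicator measurableSet_Ioo]
  refine lintegral_congr fun x => ?_
  by_cases hx : x ∈ Ioo 0 1
  · have h1 : 0 < 1 - x := by linarith [hx.2]
    have h2 := Real.rpow_pos_of_pos h1 (θ - 1)
    have h3 := hx.1
    rw [indicator_of_mem (Ioo_subset_Ioc_self hx), indicator_of_mem hx, if_pos hx.2,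
      ← ENNReal.ofReal_pow hx.1.le, ← ENNReal.ofReal_mul (by positivity)]
    congr 1
    field_simp
  · rw [indicator_of_notMem hx]
    by_cases hx' : x ∈ Ioc 0 1
    · rw [if_neg fun h => hx ⟨hx'.1, h⟩, mul_zero]
    · simp [indicator_of_notMem hx']

theorem lintegral_mul_pdDensity_two (hθ : 0 < θ) :
    ∫⁻ x, ((Ioc 0 1).indicator ENNReal.ofReal (x 0) * (Ioc 0 1).indicator ENNReal.ofReal (x 1)) *
        pdDensity θ 2 x
      = ∫⁻ x in Ioo 0 1, ENNReal.ofReal (θ * (1 - x) ^ θ) := by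
  set F : ℝ × ℝ → ℝ≥0∞ := fun p => ((Ioc 0 1).indicator ENNReal.ofReal p.1 *
    (Ioc 0 1).indicator ENNReal.ofReal p.2) *
    if p.1 + p.2 < 1 then ENNReal.ofReal (θ ^ 2 * (1 - (p.1 + p.2)) ^ (θ - 1) / (p.1 * p.2)) else 0
    with hF
  have hFm : Measurable F := by
    have h1 : Measurable fun x : ℝ => (Ioc 0 1).indicator ENNReal.ofReal x :=
      ENNReal.measurable_ofReal.indicator measurableSet_Ioc
    have h2 : Measurable fun p : ℝ × ℝ => if p.1 + p.2 < 1 then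
        ENNReal.ofReal (θ ^ 2 * (1 - (p.1 + p.2)) ^ (θ - 1) / (p.1 * p.2)) else 0 :=
      Measurable.ite (measurableSet_lt (by fun_prop) measurable_const) (by fun_prop)
        measurable_const
    exact ((h1.comp measurable_fst).mul (h1.comp measurable_snd)).mul h2
  have e : ∀ x : Fin 2 → ℝ, ((Ioc 0 1).indicator ENNReal.ofReal (x 0) *
      (Ioc 0 1).indicator ENNReal.ofReal (x 1)) * pdDensity θ 2 x
      = F (MeasurableEquiv.finTwoArrow x) := by
    intro x
    simp [pdDensity, hF, MeasurableEquiv.finTwoArrow, Fin.prod_univ_two, Fin.sum_univ_two]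
  simp_rw [e]
  rw [(volume_preserving_finTwoArrow ℝ).lintegral_comp hFm, Measure.volume_eq_prod,
    lintegral_prod _ hFm.aemeasurable, ← lintegral_indicator measurableSet_Ioo]
  refine lintegral_congr fun x => ?_
  by_cases hx : x ∈ Ioo 0 1
  · have hx1 : 0 < 1 - x := by linarith [hx.2]
    have hx0 := hx.1
    rw [indicator_of_mem hx, ENNReal.ofReal_mul hθ.le, ← lintegral_Ioo_sub_rpow hθ hx1,
      ← lintegral_const_mul' _ _ (by simp), ← lintegral_indicator measurableSet_Ioo]
    refine lintegral_congr fun y => ?_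
    simp only [hF]
    rw [indicator_of_mem (Ioo_subset_Ioc_self hx)]
    by_cases hy : y ∈ Ioo 0 (1 - x)
    · have hy0 := hy.1
      have h1 : 0 < 1 - x - y := by linarith [hy.2]
      have h2 := Real.rpow_pos_of_pos h1 (θ - 1)
      rw [indicator_of_mem hy, indicator_of_mem (show y ∈ Ioc 0 1 from ⟨hy.1, by linarith [hy.2]⟩),
        if_pos (by linarith [hy.2]), ← ENNReal.ofReal_mul hx0.le,
        ← ENNReal.ofReal_mul (by positivity), ← ENNReal.ofReal_mul hθ.le, ← sub_sub]
      congr 1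
      field_simp
    · rw [indicator_of_notMem hy]
      by_cases hy' : y ∈ Ioc 0 1
      · rw [if_neg fun h => hy ⟨hy'.1, by linarith⟩, mul_zero]
      · simp [indicator_of_notMem hy']
  · rw [indicator_of_notMem hx]
    by_cases hx' : x ∈ Ioc 0 1
    · have hx1 : x = 1 := le_antisymm hx'.2 (not_lt.1 fun h => hx ⟨hx'.1, h⟩)
      rw [← lintegral_zero]
      refine lintegral_congr fun y => ?_
      simp only [hF]
      by_cases hy' : y ∈ Ioc 0 1
      · rw [if_neg (by linarith [hy'.1]), mul_zero]
      · simp [indicator_of_notMem hy']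
    · simp [hF, indicator_of_notMem hx']

/-- The integrands add up to `θ (1 - x) ^ (θ - 1)`, a probability density. The value 1 is the
largest that `T ≤ 1` permits for `𝔼 T²`, which leaves no room for multiple points. -/
theorem lintegral_sq_add_lintegral_mul_pdDensity (hθ : 0 < θ) :
    (∫⁻ x, ((Ioc 0 1).indicator ENNReal.ofReal (x 0)) ^ 2 * pdDensity θ 1 x)
      + (∫⁻ x, ((Ioc 0 1).indicator ENNReal.ofReal (x 0) *
        (Ioc 0 1).indicator ENNReal.ofReal (x 1)) * pdDensity θ 2 x) = 1 := by
  rw [lintegral_sq_mul_pdDensity_one hθ, lintegral_mul_pdDensity_two hθ,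
    ← lintegral_add_right _ (by fun_prop)]
  have h := lintegral_Ioo_sub_rpow hθ one_pos
  rw [Real.one_rpow, ENNReal.ofReal_one] at h
  rw [← h]
  refine setLIntegral_congr_fun measurableSet_Ioo fun x hx => ?_
  have h1 : 0 < 1 - x := by linarith [hx.2]
  have h2 := Real.rpow_pos_of_pos h1 (θ - 1)
  have h3 := Real.rpow_pos_of_pos h1 θ
  have h0 := hx.1
  rw [← ENNReal.ofReal_add (by positivity) (by positivity)]
  congr 1
  have : (1 - x) ^ θ = (1 - x) ^ (θ - 1) * (1 - x) := by
    rw [Real.rpow_sub_one h1.ne', div_mul_cancel₀ _ h1.ne']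
  rw [this]
  ring

end SecondMoment

/-! ### Almost surely there are no multiple points. -/

section Simple

open Filter Topology

variable {θ : ℝ}

theorem UnitMultiset.sum_cellLeft_mul_count_le (A : UnitMultiset) (n : ℕ) :
    ∑ j ∈ cellIndices n, ENNReal.ofReal (cellLeft n j) * A.count (dyadicCell n j) ≤ A.sum := by
  calc _ ≤ ∑ j ∈ cellIndices n, ∫⁻ x in dyadicCell n j, ENNReal.ofReal x ∂A.toMeasure := by
        refine Finset.sum_le_sum fun j _ => ?_
        rw [← A.toMeasure_apply (measurableSet_dyadicCell n j), ← setLIntegral_const]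
        exact setLIntegral_mono ENNReal.measurable_ofReal
          fun x hx => ENNReal.ofReal_le_ofReal (cellLeft_lt hx).le
    _ = ∫⁻ x in ⋃ j ∈ cellIndices n, dyadicCell n j, ENNReal.ofReal x ∂A.toMeasure :=
        (lintegral_biUnion_finset (fun i _ j _ h => disjoint_dyadicCell n h)
          (fun j _ => measurableSet_dyadicCell n j) _).symm
    _ ≤ A.sum := by
        rw [A.sum_eq_lintegral]
        exact setLIntegral_le_lintegral _ _

theorem add_indicator_two_le_le_mul_self {N : ℝ≥0∞} (h : N ≠ ∞ → ∃ m : ℕ, N = m) :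
    N + (Ici 2).indicator 1 N ≤ N * N := by
  by_cases hN : N = ∞
  · simp [hN]
  · obtain ⟨m, rfl⟩ := h hN
    rcases lt_or_ge m 2 with hm | hm
    · interval_cases m <;> simp
    · have h2 : (m : ℝ≥0∞) ∈ Ici 2 := by
        rw [mem_Ici]; exact_mod_cast hm
      rw [indicator_of_mem h2, Pi.one_apply]
      exact_mod_cast (by nlinarith : m + 1 ≤ m * m)

/-- Expands the square of `∑ cellLeft · N_j ≤ T ≤ 1` and bounds the diagonal below by `N² ≥ N + 1_{N
≥ 2}`, valid since counts are integers or infinite. Everything but the last term is given by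
intensities. -/
theorem second_moment_ineq {Q : Measure UnitMultiset} [IsProbabilityMeasure Q]
    (hQ : ∀ᵐ A ∂Q, A.sum ≤ 1)
    (h : ∀ k : ℕ, 1 ≤ k → HasMultiIntensityDensity Q id k (pdDensity θ k)) (n : ℕ) :
    (∑ j ∈ cellIndices n, ENNReal.ofReal (cellLeft n j) ^ 2 *
        ∫⁻ x in univ.pi fun _ => dyadicCell n j, pdDensity θ 1 x)
      + (∑ p ∈ (cellIndices n).offDiag,
        (ENNReal.ofReal (cellLeft n p.1) * ENNReal.ofReal (cellLeft n p.2)) *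
        ∫⁻ x in univ.pi fun i => dyadicCell n (![p.1, p.2] i), pdDensity θ 2 x)
      + ∑ j ∈ cellIndices n, ENNReal.ofReal (cellLeft n j) ^ 2 *
        Q {A | 2 ≤ A.count (dyadicCell n j)} ≤ 1 := by
  have hcm : ∀ j, Measurable fun A : UnitMultiset => A.count (dyadicCell n j) := fun j =>
    UnitMultiset.measurable_count (measurableSet_dyadicCell n j)
  have h1 : ∀ j ∈ cellIndices n, ∫⁻ x in univ.pi fun _ : Fin 1 => dyadicCell n j, pdDensity θ 1 x
      = ∫⁻ A, A.count (dyadicCell n j) ∂Q := by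
    intro j hj
    rw [← lintegral_prod_count_dyadicCell hQ (h 1 le_rfl) n (e := fun _ => j)
      (Function.injective_of_subsingleton _) fun _ => hj]
    simp
  have h2 : ∀ p ∈ (cellIndices n).offDiag, ∫⁻ x in univ.pi fun i => dyadicCell n (![p.1, p.2] i),
      pdDensity θ 2 x = ∫⁻ A, A.count (dyadicCell n p.1) * A.count (dyadicCell n p.2) ∂Q := by
    intro p hp
    rw [Finset.mem_offDiag] at hp
    rw [← lintegral_prod_count_dyadicCell hQ (h 2 one_le_two) n (e := ![p.1, p.2])]
    · simp [Fin.prod_univ_two]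
    · intro i j hij
      fin_cases i <;> fin_cases j <;> simp_all [eq_comm]
    · intro i
      fin_cases i
      exacts [hp.1, hp.2.1]
  have h3 : ∀ j, Q {A | 2 ≤ A.count (dyadicCell n j)}
      = ∫⁻ A, (Ici 2).indicator 1 (A.count (dyadicCell n j)) ∂Q := by
    intro j
    exact (lintegral_indicator_one (μ := Q) (hcm j measurableSet_Ici)).symm
  have hm3 : ∀ j, Measurable fun A : UnitMultiset =>
      (Ici (2 : ℝ≥0∞)).indicator (1 : ℝ≥0∞ → ℝ≥0∞) (A.count (dyadicCell n j)) := fun j =>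
    (measurable_one.indicator measurableSet_Ici).comp (hcm j)
  have e1 : ∑ j ∈ cellIndices n, ENNReal.ofReal (cellLeft n j) ^ 2 *
        ∫⁻ x in univ.pi fun _ : Fin 1 => dyadicCell n j, pdDensity θ 1 x
      = ∑ j ∈ cellIndices n, ENNReal.ofReal (cellLeft n j) ^ 2 *
        ∫⁻ A, A.count (dyadicCell n j) ∂Q := Finset.sum_congr rfl fun j hj => by rw [h1 j hj]
  have e2 : ∑ p ∈ (cellIndices n).offDiag,
        (ENNReal.ofReal (cellLeft n p.1) * ENNReal.ofReal (cellLeft n p.2)) *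
        ∫⁻ x in univ.pi fun i => dyadicCell n (![p.1, p.2] i), pdDensity θ 2 x
      = ∑ p ∈ (cellIndices n).offDiag,
        (ENNReal.ofReal (cellLeft n p.1) * ENNReal.ofReal (cellLeft n p.2)) *
        ∫⁻ A, A.count (dyadicCell n p.1) * A.count (dyadicCell n p.2) ∂Q :=
    Finset.sum_congr rfl fun p hp => by rw [h2 p hp]
  have hmm : ∀ p : ℕ × ℕ, Measurable fun A : UnitMultiset =>
      A.count (dyadicCell n p.1) * A.count (dyadicCell n p.2) := fun p => (hcm p.1).mul (hcm p.2)
  rw [e1, e2]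
  simp_rw [h3, ← lintegral_const_mul _ (hcm _), ← lintegral_const_mul _ (hm3 _),
    ← lintegral_const_mul _ (hmm _)]
  rw [← lintegral_finsetSum _ fun j _ => (hcm j).const_mul _,
    ← lintegral_finsetSum _ fun p _ => (hmm p).const_mul _,
    ← lintegral_finsetSum _ fun j _ => (hm3 j).const_mul _,
    ← lintegral_add_left (Finset.measurable_fun_sum _ fun j _ => (hcm j).const_mul _),
    ← lintegral_add_right _ (Finset.measurable_fun_sum _ fun j _ => (hm3 j).const_mul _)]
  refine (lintegral_mono_ae (g := fun _ => 1) ?_).trans (by simp)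
  filter_upwards [hQ] with A hA
  have hT := (A.sum_cellLeft_mul_count_le n).trans hA
  have hTT := mul_le_one' hT hT
  rw [sum_mul_sum_eq_add_offDiag] at hTT
  refine le_trans ?_ hTT
  rw [add_right_comm, ← Finset.sum_add_distrib]
  refine add_le_add (Finset.sum_le_sum fun j _ => ?_) (Finset.sum_le_sum fun p _ => ?_)
  · have := add_indicator_two_le_le_mul_self (N := A.count (dyadicCell n j))
      A.exists_count_eq_natCast
    calc _ = ENNReal.ofReal (cellLeft n j) ^ 2 * (A.count (dyadicCell n j)
            + (Ici 2).indicator 1 (A.count (dyadicCell n j))) := by ring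
      _ ≤ ENNReal.ofReal (cellLeft n j) ^ 2 *
            (A.count (dyadicCell n j) * A.count (dyadicCell n j)) := by gcongr
      _ = _ := by ring
  · exact le_of_eq (by ring)

/-- A random multiset with total sum at most `1` and the multi-intensities of the
Poisson–Dirichlet process almost surely has no multiple points. -/
theorem ae_mult_le_one (hθ : 0 < θ) {Q : Measure UnitMultiset} [IsProbabilityMeasure Q]
    (hQ : ∀ᵐ A ∂Q, A.sum ≤ 1)
    (h : ∀ k : ℕ, 1 ≤ k → HasMultiIntensityDensity Q id k (pdDensity θ k)) :
    ∀ᵐ A ∂Q, ∀ x, A.mult x ≤ 1 := by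
  have hone := lintegral_sq_add_lintegral_mul_pdDensity hθ
  have key : ∀ ε : ℝ, 0 < ε → Q {A | ∃ x, ε < x ∧ 2 ≤ A.mult x} = 0 := by
    intro ε hε
    have hfin1 := ne_top_of_le_ne_top ENNReal.one_ne_top (le_self_add.trans hone.le)
    have hfin2 := ne_top_of_le_ne_top ENNReal.one_ne_top (le_add_self.trans hone.le)
    have hlim := (tendsto_sum_sq_setLIntegral (measurable_pdDensity θ 1) (pdDensity_ne_top θ 1)
      hfin1).add (tendsto_sum_offDiag_setLIntegral (measurable_pdDensity θ 2)
      (pdDensity_ne_top θ 2) hfin2)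
    rw [hone] at hlim
    -- The two intensity sums already tend to 1. A multiple point above `ε` lies in a cell with left
    -- end at least `ε / 2` once the width is below `ε / 2`.
    have hle : 1 + ENNReal.ofReal (ε / 2) ^ 2 * Q {A | ∃ x, ε < x ∧ 2 ≤ A.mult x} ≤ 1 := by
      refine le_of_tendsto (hlim.add_const _) ?_
      filter_upwards [(tendsto_two_pow_mul_atTop (half_pos hε)).eventually_gt_atTop 1] with n hn
      refine le_trans ?_ (second_moment_ineq hQ h n)
      refine add_le_add_right ?_ _
      have hn' : (1 : ℝ) / 2 ^ n < ε / 2 := by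
        rw [div_lt_iff₀ (by positivity)]; linarith
      have hsub : {A : UnitMultiset | ∃ x, ε < x ∧ 2 ≤ A.mult x} ⊆
          ⋃ j ∈ (cellIndices n).filter fun j => ε / 2 ≤ cellLeft n j,
            {A | 2 ≤ A.count (dyadicCell n j)} := by
        rintro A ⟨x, hx, hA⟩
        have hx1 : x ∈ Ioc (0 : ℝ) 1 := A.mem_Ioc x (by omega)
        have h2x : 1 < 2 ^ n * x := by
          have : (0 : ℝ) < 2 ^ n := by positivity
          nlinarith
        obtain ⟨j, hj, hxj⟩ := exists_mem_dyadicCell hx1 h2x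
        simp only [mem_iUnion, Finset.mem_filter]
        refine ⟨j, ⟨hj, by linarith [lt_cellLeft_add hxj]⟩, ?_⟩
        refine le_trans ?_ (A.mult_le_count hxj)
        exact_mod_cast hA
      calc _ ≤ ENNReal.ofReal (ε / 2) ^ 2 * ∑ j ∈ (cellIndices n).filter
              fun j => ε / 2 ≤ cellLeft n j, Q {A | 2 ≤ A.count (dyadicCell n j)} := by
            gcongr
            exact (measure_mono hsub).trans (measure_biUnion_finset_le _ _)
        _ ≤ ∑ j ∈ (cellIndices n).filter fun j => ε / 2 ≤ cellLeft n j,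
              ENNReal.ofReal (cellLeft n j) ^ 2 * Q {A | 2 ≤ A.count (dyadicCell n j)} := by
            rw [Finset.mul_sum]
            refine Finset.sum_le_sum fun j hj => ?_
            have := (Finset.mem_filter.1 hj).2
            gcongr
        _ ≤ _ := Finset.sum_le_sum_of_subset (Finset.filter_subset _ _)
    have h0 : ENNReal.ofReal (ε / 2) ^ 2 * Q {A | ∃ x, ε < x ∧ 2 ≤ A.mult x} = 0 := by
      have := ENNReal.le_of_add_le_add_left ENNReal.one_ne_top (hle.trans_eq (add_zero 1).symm)
      exact le_antisymm this zero_le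
    rcases mul_eq_zero.1 h0 with h0 | h0
    · have := (ENNReal.ofReal_pos.2 (half_pos hε)).ne'
      exact absurd h0 (pow_ne_zero 2 this)
    · exact h0
  have hall : ∀ᵐ A ∂Q, ∀ m : ℕ, ¬ ∃ x, 1 / ((m : ℝ) + 1) < x ∧ 2 ≤ A.mult x := by
    rw [ae_all_iff]
    intro m
    rw [ae_iff]
    simpa only [not_not] using key (1 / ((m : ℝ) + 1)) (by positivity)
  filter_upwards [hall] with A hA x
  by_contra hc
  have hx := A.mem_Ioc x (by omega)
  obtain ⟨m, hm⟩ := exists_nat_one_div_lt hx.1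
  exact hA m ⟨x, hm, by omega⟩

end Simple

/-! ### Void probabilities are determined by the intensities. -/

section Voids

open Filter Topology

namespace UnitMultiset

theorem count_union_eq_zero (A : UnitMultiset) {S T : Set ℝ} (hS : MeasurableSet S)
    (hT : MeasurableSet T) : A.count (S ∪ T) = 0 ↔ A.count S = 0 ∧ A.count T = 0 := by
  rw [← A.toMeasure_apply hS, ← A.toMeasure_apply hT, ← A.toMeasure_apply (hS.union hT),
    measure_union_null_iff]

theorem count_le_one_of_subsingleton (A : UnitMultiset) (h : ∀ x, A.mult x ≤ 1) {S : Set ℝ}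
    (hS : ∀ x ∈ S, ∀ y ∈ S, A.mult x ≠ 0 → A.mult y ≠ 0 → x = y) : A.count S ≤ 1 := by
  by_cases hx : ∃ x : S, A.mult x ≠ 0
  · obtain ⟨x, hx⟩ := hx
    rw [count, tsum_eq_single x]
    · exact_mod_cast h x
    · intro y hy
      by_contra hc
      exact hy (Subtype.ext (hS y y.2 x x.2 (by simpa using hc) hx))
  · push Not at hx
    simp [count, hx]

/-- Only finitely many points lie above `ε`, so they have a positive minimal distance. -/
theorem eventually_count_le_one (A : UnitMultiset) (hA : A.sum ≤ 1) (h : ∀ x, A.mult x ≤ 1) {ε : ℝ}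
    (hε : 0 < ε) : ∀ᶠ m : ℕ in atTop, ∀ S : Set ℝ, S ⊆ Ici ε →
      (∀ x ∈ S, ∀ y ∈ S, 2 ^ m * |x - y| ≤ 1) → A.count S ≤ 1 := by
  have hc : A.count (Ici ε) ≠ ∞ := (A.count_lt_top hA hε measurableSet_Ici fun x hx => hx).ne
  have hfin := (ENNReal.finite_const_le_of_tsum_ne_top hc one_ne_zero).image Subtype.val
  have hev : ∀ᶠ m : ℕ in atTop, ∀ x ∈ Subtype.val '' {x : Ici ε | (1 : ℝ≥0∞) ≤ (A.mult x : ℝ≥0∞)},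
      ∀ y ∈ Subtype.val '' {x : Ici ε | (1 : ℝ≥0∞) ≤ (A.mult x : ℝ≥0∞)}, x ≠ y →
        1 < 2 ^ m * |x - y| := by
    rw [eventually_all_finite hfin]
    intro x _
    rw [eventually_all_finite hfin]
    intro y _
    by_cases hxy : x = y
    · exact Eventually.of_forall fun m hc => absurd hxy hc
    · filter_upwards [(tendsto_two_pow_mul_atTop
        (abs_pos.2 (sub_ne_zero.2 hxy))).eventually_gt_atTop 1] with m hm _ using hm
  filter_upwards [hev] with m hm S hS hSd
  refine A.count_le_one_of_subsingleton h fun x hx y hy hx0 hy0 => ?_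
  by_contra hxy
  have hmem : ∀ z ∈ S, A.mult z ≠ 0 →
      z ∈ Subtype.val '' {x : Ici ε | (1 : ℝ≥0∞) ≤ (A.mult x : ℝ≥0∞)} := fun z hz hz0 =>
    ⟨⟨z, hS hz⟩, by simpa [Nat.one_le_iff_ne_zero] using hz0, rfl⟩
  exact absurd (hSd x hx y hy) (not_le.2 (hm x (hmem x hx hx0) y (hmem y hy hy0) hxy))

theorem toMeasure_compl_Ioc (A : UnitMultiset) : A.toMeasure (Ioc 0 1)ᶜ = 0 := by
  rw [A.toMeasure_apply measurableSet_Ioc.compl, count, ENNReal.tsum_eq_zero]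
  rintro ⟨x, hx⟩
  by_contra hc
  exact hx (A.mem_Ioc x (by simpa using hc))

end UnitMultiset

/-- A union of dyadic intervals of length `2^(-n)`. -/
def dyadicUnion (n : ℕ) (J : Finset ℕ) : Set ℝ := ⋃ j ∈ J, dyadicCell n j

theorem measurableSet_dyadicUnion (n : ℕ) (J : Finset ℕ) : MeasurableSet (dyadicUnion n J) :=
  J.measurableSet_biUnion fun j _ => measurableSet_dyadicCell n j

theorem dyadicCell_eq_union {n j : ℕ} (hj : 1 ≤ j) :
    dyadicCell n j = dyadicCell (n + 1) (2 * j - 1) ∪ dyadicCell (n + 1) (2 * j) := by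
  have h1 : ((2 * j - 1 : ℕ) : ℝ) = 2 * j - 1 := by
    rw [Nat.cast_sub (by omega)]; push_cast; ring
  have e1 : ((j : ℝ) - 1) / 2 ^ n = (2 * j - 1 - 1) / 2 ^ (n + 1) := by
    rw [pow_succ]; field_simp; ring
  have e2 : (j : ℝ) / 2 ^ n = 2 * j / 2 ^ (n + 1) := by
    rw [pow_succ]; field_simp
  simp only [dyadicCell, h1]
  push_cast
  rw [Ioc_union_Ioc_eq_Ioc, e1, e2]
  · gcongr; linarith
  · gcongr; linarith

theorem exists_dyadicUnion_eq_succ {n : ℕ} {J : Finset ℕ} (hJ : J ⊆ cellIndices n) :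
    ∃ K ⊆ cellIndices (n + 1), dyadicUnion (n + 1) K = dyadicUnion n J := by
  refine ⟨J.biUnion fun j => {2 * j - 1, 2 * j}, ?_, ?_⟩
  · intro k hk
    simp only [Finset.mem_biUnion, Finset.mem_insert, Finset.mem_singleton] at hk
    obtain ⟨j, hj, hk⟩ := hk
    have := Finset.mem_Icc.1 (hJ hj)
    rw [Finset.mem_Icc, pow_succ]
    omega
  · ext x
    simp only [dyadicUnion, mem_iUnion, Finset.mem_biUnion, Finset.mem_insert,
      Finset.mem_singleton, exists_prop]
    constructor
    · rintro ⟨k, ⟨j, hj, hk⟩, hx⟩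
      refine ⟨j, hj, ?_⟩
      rw [dyadicCell_eq_union (by have := Finset.mem_Icc.1 (hJ hj); omega)]
      rcases hk with rfl | rfl
      exacts [Or.inl hx, Or.inr hx]
    · rintro ⟨j, hj, hx⟩
      rw [dyadicCell_eq_union (by have := Finset.mem_Icc.1 (hJ hj); omega)] at hx
      rcases hx with hx | hx
      exacts [⟨_, ⟨j, hj, Or.inl rfl⟩, hx⟩, ⟨_, ⟨j, hj, Or.inr rfl⟩, hx⟩]

theorem exists_dyadicUnion_eq {n m : ℕ} (hnm : n ≤ m) {J : Finset ℕ} (hJ : J ⊆ cellIndices n) :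
    ∃ K ⊆ cellIndices m, dyadicUnion m K = dyadicUnion n J := by
  induction m, hnm using Nat.le_induction with
  | base => exact ⟨J, hJ, rfl⟩
  | succ m _ ih =>
    obtain ⟨K, hK, hKJ⟩ := ih
    obtain ⟨K', hK', hKJ'⟩ := exists_dyadicUnion_eq_succ hK
    exact ⟨K', hK', hKJ'.trans hKJ⟩

theorem dyadicUnion_union (n : ℕ) (J K : Finset ℕ) :
    dyadicUnion n (J ∪ K) = dyadicUnion n J ∪ dyadicUnion n K :=
  Finset.set_biUnion_union J K _

theorem dyadicUnion_subset_Ici {n : ℕ} {J : Finset ℕ} (hJ : J ⊆ cellIndices n) :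
    dyadicUnion n J ⊆ Ici (1 / 2 ^ n) := by
  intro x hx
  simp only [dyadicUnion, mem_iUnion] at hx
  obtain ⟨j, hj, hx⟩ := hx
  refine le_trans ?_ (cellLeft_lt hx).le
  have : (2 : ℝ) ≤ j := by exact_mod_cast (Finset.mem_Icc.1 (hJ hj)).1
  rw [cellLeft]
  gcongr
  linarith

theorem UnitMultiset.count_dyadicUnion (A : UnitMultiset) (n : ℕ) (J : Finset ℕ) :
    A.count (dyadicUnion n J) = ∑ j ∈ J, A.count (dyadicCell n j) := by
  simp_rw [← A.toMeasure_apply (measurableSet_dyadicUnion n J),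
    ← A.toMeasure_apply (measurableSet_dyadicCell n _)]
  exact measure_biUnion_finset (fun i _ j _ h => disjoint_dyadicCell n h)
    fun j _ => measurableSet_dyadicCell n j

theorem UnitMultiset.eventually_count_dyadicCell_le_one (A : UnitMultiset) (hA : A.sum ≤ 1)
    (h : ∀ x, A.mult x ≤ 1) {ε : ℝ} (hε : 0 < ε) :
    ∀ᶠ m in atTop, ∀ j, dyadicCell m j ⊆ Ici ε → A.count (dyadicCell m j) ≤ 1 := by
  filter_upwards [A.eventually_count_le_one hA h hε] with m hm j hj
  refine hm _ hj fun x hx y hy => ?_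
  have e0 := lt_cellLeft_add hx
  have e1 := lt_cellLeft_add hy
  have e2 := cellLeft_lt hx
  have e3 := cellLeft_lt hy
  rw [← le_div_iff₀' (by positivity), abs_le]
  constructor <;> linarith

/-- `∏ (1 - N_j)` over dyadic intervals; it approximates the indicator of the event that there are
no points in their union. -/
noncomputable def voidProd (n : ℕ) (J : Finset ℕ) (A : UnitMultiset) : ℝ :=
  ∏ j ∈ J, (1 - (A.count (dyadicCell n j)).toReal)

theorem measurable_voidProd (n : ℕ) (J : Finset ℕ) : Measurable (voidProd n J) :=
  Finset.measurable_fun_prod _ fun j _ => measurable_const.sub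
    (UnitMultiset.measurable_count (measurableSet_dyadicCell n j)).ennreal_toReal

/-- From `|1 - N| ≤ exp N` and at most `1 / ε` points in all. The bound does not depend on the
level, so it dominates along refinements. -/
theorem abs_voidProd_le {A : UnitMultiset} (hA : A.sum ≤ 1) {n : ℕ} {J : Finset ℕ} {ε : ℝ}
    (hε : 0 < ε) (hJ : dyadicUnion n J ⊆ Ici ε) : |voidProd n J A| ≤ Real.exp (1 / ε) := by
  have hle := A.count_le hA hε (measurableSet_dyadicUnion n J) fun x hx => hJ hx
  have hsum : ∑ j ∈ J, (A.count (dyadicCell n j)).toReal ≤ 1 / ε := by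
    rw [A.count_dyadicUnion] at hle
    rw [← ENNReal.toReal_sum fun j hj => ?_]
    · exact ENNReal.toReal_le_of_le_ofReal (by positivity) hle
    · exact ne_top_of_le_ne_top ENNReal.ofReal_ne_top
        ((Finset.single_le_sum (f := fun j => A.count (dyadicCell n j))
          (fun _ _ => zero_le) hj).trans hle)
  calc |voidProd n J A| = ∏ j ∈ J, |1 - (A.count (dyadicCell n j)).toReal| := by
        rw [voidProd, Finset.abs_prod]
    _ ≤ ∏ j ∈ J, Real.exp (A.count (dyadicCell n j)).toReal := by
        refine Finset.prod_le_prod (fun _ _ => abs_nonneg _) fun j _ => ?_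
        have h0 : 0 ≤ (A.count (dyadicCell n j)).toReal := ENNReal.toReal_nonneg
        refine le_trans ?_ (Real.add_one_le_exp _)
        rw [abs_le]
        constructor <;> linarith
    _ = Real.exp (∑ j ∈ J, (A.count (dyadicCell n j)).toReal) := (Real.exp_sum _ _).symm
    _ ≤ _ := Real.exp_le_exp.2 hsum

theorem voidProd_eq_indicator {A : UnitMultiset} {n : ℕ} {J : Finset ℕ}
    (h : ∀ j ∈ J, A.count (dyadicCell n j) ≤ 1) :
    voidProd n J A = {A | A.count (dyadicUnion n J) = 0}.indicator 1 A := by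
  by_cases h0 : A.count (dyadicUnion n J) = 0
  · rw [indicator_of_mem (show A ∈ {A | UnitMultiset.count A (dyadicUnion n J) = 0} from h0)]
    rw [A.count_dyadicUnion, Finset.sum_eq_zero_iff] at h0
    rw [voidProd, Finset.prod_congr rfl fun j hj => by rw [h0 j hj]]
    simp
  · rw [indicator_of_notMem (show A ∉ {A | UnitMultiset.count A (dyadicUnion n J) = 0} from h0)]
    rw [A.count_dyadicUnion, Finset.sum_eq_zero_iff] at h0
    push Not at h0
    obtain ⟨j, hj, hj0⟩ := h0
    refine Finset.prod_eq_zero hj ?_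
    obtain ⟨m, hm⟩ := A.exists_count_eq_natCast (ne_top_of_le_ne_top ENNReal.one_ne_top (h j hj))
    have h1 := h j hj
    rw [hm] at h1 hj0 ⊢
    have : m = 1 := le_antisymm (by exact_mod_cast h1) (Nat.one_le_iff_ne_zero.2 (by simpa using hj0))
    simp [this]

theorem lintegral_finset_prod_count_eq {Q₁ Q₂ : Measure UnitMultiset}
    [IsProbabilityMeasure Q₁] [IsProbabilityMeasure Q₂]
    (hQ₁ : ∀ᵐ A ∂Q₁, A.sum ≤ 1) (hQ₂ : ∀ᵐ A ∂Q₂, A.sum ≤ 1)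
    {f : (k : ℕ) → (Fin k → ℝ) → ℝ≥0∞}
    (h₁ : ∀ k : ℕ, 1 ≤ k → HasMultiIntensityDensity Q₁ id k (f k))
    (h₂ : ∀ k : ℕ, 1 ≤ k → HasMultiIntensityDensity Q₂ id k (f k)) {n : ℕ} {J : Finset ℕ}
    (hJ : J ⊆ cellIndices n) :
    ∫⁻ A, ∏ j ∈ J, A.count (dyadicCell n j) ∂Q₁ = ∫⁻ A, ∏ j ∈ J, A.count (dyadicCell n j) ∂Q₂ := by
  -- The intensity hypothesis starts at `k = 1`; for the empty product both sides are total masses.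
  rcases J.eq_empty_or_nonempty with rfl | hne
  · simp
  set e : Fin J.card → ℕ := fun i => (J.equivFin.symm i : ℕ) with he
  have hinj : Function.Injective e := Subtype.val_injective.comp J.equivFin.symm.injective
  have hmem : ∀ i, e i ∈ cellIndices n := fun i => hJ (J.equivFin.symm i).2
  have hprod : ∀ A : UnitMultiset, ∏ j ∈ J, A.count (dyadicCell n j)
      = ∏ i, A.count (dyadicCell n (e i)) := by
    intro A
    rw [← Finset.prod_coe_sort]
    exact (Equiv.prod_comp J.equivFin.symm fun j : J => A.count (dyadicCell n j)).symm
  simp_rw [hprod]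
  rw [lintegral_prod_count_dyadicCell hQ₁ (h₁ _ hne.card_pos) n hinj hmem,
    lintegral_prod_count_dyadicCell hQ₂ (h₂ _ hne.card_pos) n hinj hmem]

/-- Each factor is linear in its own `N_j`, so only products over distinct cells occur, and these
are fixed by the intensities. -/
theorem integral_voidProd {Q : Measure UnitMultiset} [IsProbabilityMeasure Q]
    (hQ : ∀ᵐ A ∂Q, A.sum ≤ 1) {n : ℕ} {J : Finset ℕ} (hJ : J ⊆ cellIndices n) :
    ∫ A, voidProd n J A ∂Q = ∑ T ∈ J.powerset, (-1) ^ T.card *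
      (∫⁻ A, ∏ j ∈ T, A.count (dyadicCell n j) ∂Q).toReal := by
  have hcm : ∀ j, Measurable fun A : UnitMultiset => A.count (dyadicCell n j) := fun j =>
    UnitMultiset.measurable_count (measurableSet_dyadicCell n j)
  have hcl : ∀ᵐ A ∂Q, ∀ j ∈ J, A.count (dyadicCell n j) ≤ ENNReal.ofReal (1 / cellLeft n j) := by
    filter_upwards [hQ] with A hA j hj
    exact A.count_le hA (cellLeft_pos n (Finset.mem_Icc.1 (hJ hj)).1)
      (measurableSet_dyadicCell n j) fun x hx => (cellLeft_lt hx).le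
  have hT : ∀ T ∈ J.powerset, ∀ᵐ A ∂Q, ∏ j ∈ T, A.count (dyadicCell n j)
      ≤ ∏ j ∈ T, ENNReal.ofReal (1 / cellLeft n j) := by
    intro T hT
    filter_upwards [hcl] with A hA
    exact Finset.prod_le_prod' fun j hj => hA j (Finset.mem_powerset.1 hT hj)
  have hfin : ∀ T ∈ J.powerset, ∏ j ∈ T, ENNReal.ofReal (1 / cellLeft n j) ≠ ∞ := fun T _ =>
    ENNReal.prod_ne_top fun j _ => ENNReal.ofReal_ne_top
  have hm : ∀ T : Finset ℕ, Measurable fun A : UnitMultiset =>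
      ∏ j ∈ T, A.count (dyadicCell n j) := fun T =>
    Finset.measurable_fun_prod _ fun j _ => hcm j
  have hexp : ∀ A : UnitMultiset, voidProd n J A = ∑ T ∈ J.powerset, (-1) ^ T.card *
      (∏ j ∈ T, A.count (dyadicCell n j)).toReal := by
    intro A
    simp_rw [voidProd, sub_eq_add_neg, ENNReal.toReal_prod]
    rw [Finset.prod_one_add]
    refine Finset.sum_congr rfl fun T _ => ?_
    rw [Finset.prod_neg]
  simp_rw [hexp]
  rw [integral_finsetSum]
  · refine Finset.sum_congr rfl fun T hTJ => ?_
    rw [integral_const_mul, integral_toReal (hm T).aemeasurable]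
    filter_upwards [hT T hTJ] with A hA
    exact hA.trans_lt (hfin T hTJ).lt_top
  · intro T hTJ
    refine Integrable.const_mul (integrable_toReal_of_lintegral_ne_top (hm T).aemeasurable ?_) _
    refine ne_top_of_le_ne_top (hfin T hTJ) ((lintegral_mono_ae (hT T hTJ)).trans ?_)
    simp

theorem tendsto_integral_voidProd {Q : Measure UnitMultiset} [IsProbabilityMeasure Q]
    (hQ : ∀ᵐ A ∂Q, A.sum ≤ 1) (hs : ∀ᵐ A ∂Q, ∀ x, A.mult x ≤ 1) {S : Set ℝ} {n : ℕ}
    (hS : MeasurableSet S) {ε : ℝ} (hε : 0 < ε) (hSε : S ⊆ Ici ε) {K : ℕ → Finset ℕ}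
    (hK : ∀ m, dyadicUnion (n + m) (K m) = S) :
    Tendsto (fun m => ∫ A, voidProd (n + m) (K m) A ∂Q) atTop (𝓝 (Q.real {A | A.count S = 0})) := by
  have hm : MeasurableSet {A : UnitMultiset | A.count S = 0} :=
    UnitMultiset.measurable_count hS (measurableSet_singleton 0)
  rw [← integral_indicator_one hm]
  refine tendsto_integral_of_dominated_convergence (fun _ => Real.exp (1 / ε))
    (fun m => (measurable_voidProd _ _).aestronglyMeasurable) (integrable_const _)
    (fun m => ?_) ?_
  · filter_upwards [hQ] with A hA
    exact abs_voidProd_le hA hε (by rw [hK]; exact hSε)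
  · filter_upwards [hQ, hs] with A hA hA'
    refine tendsto_const_nhds.congr' ?_
    have hev := (tendsto_add_atTop_nat n).eventually
      (A.eventually_count_dyadicCell_le_one hA hA' hε)
    filter_upwards [hev] with m hm
    rw [voidProd_eq_indicator, hK]
    intro j hj
    rw [add_comm n m]
    refine hm j (Subset.trans ?_ hSε)
    rw [← hK m, add_comm n m]
    exact subset_biUnion_of_mem (u := fun j => dyadicCell (m + n) j) hj

theorem measure_void_eq (θ : ℝ) (hθ : 0 < θ) {Q₁ Q₂ : Measure UnitMultiset}
    [IsProbabilityMeasure Q₁] [IsProbabilityMeasure Q₂]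
    (hQ₁ : ∀ᵐ A ∂Q₁, A.sum ≤ 1) (hQ₂ : ∀ᵐ A ∂Q₂, A.sum ≤ 1)
    (h₁ : ∀ k : ℕ, 1 ≤ k → HasMultiIntensityDensity Q₁ id k (pdDensity θ k))
    (h₂ : ∀ k : ℕ, 1 ≤ k → HasMultiIntensityDensity Q₂ id k (pdDensity θ k)) {n : ℕ} {J : Finset ℕ}
    (hJ : J ⊆ cellIndices n) :
    Q₁ {A | A.count (dyadicUnion n J) = 0} = Q₂ {A | A.count (dyadicUnion n J) = 0} := by
  choose K hK hKS using fun m : ℕ => exists_dyadicUnion_eq (Nat.le_add_right n m) hJ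
  have hε : (0 : ℝ) < 1 / 2 ^ n := by positivity
  have t₁ := tendsto_integral_voidProd hQ₁ (ae_mult_le_one hθ hQ₁ h₁)
    (measurableSet_dyadicUnion n J) hε (dyadicUnion_subset_Ici hJ) hKS
  have t₂ := tendsto_integral_voidProd hQ₂ (ae_mult_le_one hθ hQ₂ h₂)
    (measurableSet_dyadicUnion n J) hε (dyadicUnion_subset_Ici hJ) hKS
  have heq : ∀ m, ∫ A, voidProd (n + m) (K m) A ∂Q₁ = ∫ A, voidProd (n + m) (K m) A ∂Q₂ := by
    intro m
    rw [integral_voidProd hQ₁ (hK m), integral_voidProd hQ₂ (hK m)]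
    refine Finset.sum_congr rfl fun T hT => ?_
    rw [lintegral_finset_prod_count_eq hQ₁ hQ₂ h₁ h₂ ((Finset.mem_powerset.1 hT).trans (hK m))]
  simp_rw [heq] at t₁
  have := tendsto_nhds_unique t₁ t₂
  exact (measureReal_eq_measureReal_iff).1 this

end Voids

/-! ### Void events generate the σ-algebra on simple multisets; uniqueness of the law. -/

section Generation

open Filter Topology

namespace UnitMultiset

variable {α : Type*} [MeasurableSpace α] {B : α → UnitMultiset}

/-- For a simple multiset the count is the eventual number of occupied cells under refinement, and
occupation is the complement of a void event. -/
theorem measurable_count_dyadicUnion (hB : ∀ a, (B a).sum ≤ 1) (hB' : ∀ a x, (B a).mult x ≤ 1)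
    (hv : ∀ n, ∀ J ⊆ cellIndices n, MeasurableSet {a | (B a).count (dyadicUnion n J) = 0})
    {n : ℕ} {J : Finset ℕ} (hJ : J ⊆ cellIndices n) :
    Measurable fun a => (B a).count (dyadicUnion n J) := by
  choose K hK hKS using fun m : ℕ => exists_dyadicUnion_eq (Nat.le_add_left n m) hJ
  have hε : (0 : ℝ) < 1 / 2 ^ n := by positivity
  have hcell : ∀ m, ∀ j ∈ K m, MeasurableSet {a | (B a).count (dyadicCell (m + n) j) = 0}ᶜ := by
    intro m j hj
    have := hv (m + n) {j} (Finset.singleton_subset_iff.2 (hK m hj))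
    simp only [dyadicUnion, Finset.mem_singleton, iUnion_iUnion_eq_left] at this
    exact this.compl
  refine measurable_of_tendsto_metrizable (f := fun m a => ∑ j ∈ K m,
    {a | (B a).count (dyadicCell (m + n) j) = 0}ᶜ.indicator 1 a) (fun m =>
    Finset.measurable_fun_sum _ fun j hj => measurable_one.indicator (hcell m j hj)) ?_
  rw [tendsto_pi_nhds]
  intro a
  refine tendsto_const_nhds.congr' ?_
  filter_upwards [(tendsto_add_atTop_nat n).eventually
    ((B a).eventually_count_dyadicCell_le_one (hB a) (hB' a) hε)] with m hm
  rw [← hKS m, count_dyadicUnion]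
  refine Finset.sum_congr rfl fun j hj => ?_
  have hle : (B a).count (dyadicCell (m + n) j) ≤ 1 := by
    refine hm j (Subset.trans ?_ (dyadicUnion_subset_Ici hJ))
    rw [← hKS m]
    exact subset_biUnion_of_mem (u := fun j => dyadicCell (m + n) j) hj
  obtain ⟨k, hk⟩ := (B a).exists_count_eq_natCast (ne_top_of_le_ne_top ENNReal.one_ne_top hle)
  rw [hk] at hle
  have hk1 : k ≤ 1 := by exact_mod_cast hle
  simp only [indicator, mem_compl_iff, mem_ofPred_eq, hk]
  interval_cases k <;> simp

/-- Staying above `ε` makes the measures finite, so it is enough to treat the π-system of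
half-lines, each a limit of dyadic unions. -/
theorem measurable_restrict_toMeasure (hB : ∀ a, (B a).sum ≤ 1) (hB' : ∀ a x, (B a).mult x ≤ 1)
    (hv : ∀ n, ∀ J ⊆ cellIndices n, MeasurableSet {a | (B a).count (dyadicUnion n J) = 0})
    {ε : ℝ} (hε : 0 < ε) : Measurable fun a => (B a).toMeasure.restrict (Ioc ε 1) := by
  classical
  have hfin : ∀ a, IsFiniteMeasure ((B a).toMeasure.restrict (Ioc ε 1)) := fun a => ⟨by
    rw [Measure.restrict_apply_univ, (B a).toMeasure_apply measurableSet_Ioc]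
    exact (B a).count_lt_top (hB a) hε measurableSet_Ioc fun x hx => hx.1.le⟩
  have hIic : ∀ t : ℝ, Measurable fun a => (B a).toMeasure.restrict (Ioc ε 1) (Iic t) := by
    intro t
    -- Cells inside `(ε, 1]`, up to and including the one containing `t`; the overshoot beyond `t`
    -- vanishes as `m` grows.
    set J : ℕ → Finset ℕ := fun m => (cellIndices m).filter fun j =>
      ε ≤ cellLeft m j ∧ (j : ℤ) ≤ ⌈2 ^ m * t⌉ with hJ
    have hsub : ∀ m, dyadicUnion m (J m) ⊆ Ioc ε 1 := by
      intro m x hx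
      simp only [dyadicUnion, mem_iUnion, hJ, Finset.mem_filter] at hx
      obtain ⟨j, ⟨hj, hj1, _⟩, hx⟩ := hx
      exact ⟨hj1.trans_lt (cellLeft_lt hx), (dyadicCell_subset hj hx).2⟩
    refine measurable_of_tendsto_metrizable (f := fun m a => (B a).count (dyadicUnion m (J m)))
      (fun m => measurable_count_dyadicUnion hB hB' hv (Finset.filter_subset _ _)) ?_
    rw [tendsto_pi_nhds]
    intro a
    have hlim := tendsto_measure_of_tendsto_indicator_of_isFiniteMeasure (L := atTop)
      ((B a).toMeasure.restrict (Ioc ε 1)) (As := fun m => dyadicUnion m (J m))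
      (A := Ioc ε 1 ∩ Iic t) (fun m => measurableSet_dyadicUnion m _) ?_
    · rw [Measure.restrict_apply (measurableSet_Ioc.inter measurableSet_Iic),
        inter_comm (Ioc ε 1), inter_assoc, inter_self] at hlim
      rw [Measure.restrict_apply measurableSet_Iic]
      refine hlim.congr fun m => ?_
      rw [Measure.restrict_apply (measurableSet_dyadicUnion _ _), inter_eq_left.2 (hsub m),
        (B a).toMeasure_apply (measurableSet_dyadicUnion _ _)]
    · intro x
      by_cases hx : x ∈ Ioc ε 1
      · by_cases hxt : x ≤ t
        · filter_upwards [(tendsto_two_pow_mul_atTop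
            (sub_pos.2 hx.1)).eventually_gt_atTop 1] with m hm
          simp only [mem_inter_iff, hx, mem_Iic, hxt, true_and, iff_true]
          have hp : (0 : ℝ) < 2 ^ m := by positivity
          obtain ⟨j, hj, hxj⟩ := exists_mem_dyadicCell (n := m) (x := x)
            ⟨hε.trans hx.1, hx.2⟩ (by nlinarith)
          simp only [dyadicUnion, mem_iUnion, hJ, Finset.mem_filter]
          refine ⟨j, ⟨hj, ?_, ?_⟩, hxj⟩
          · have h1 := lt_cellLeft_add hxj
            have h2 : 1 / 2 ^ m < x - ε := by rw [div_lt_iff₀' hp]; exact hm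
            linarith
          · rw [← mem_dyadicCell.1 hxj]
            exact Int.ceil_le_ceil (by gcongr)
        · push Not at hxt
          filter_upwards [(tendsto_two_pow_mul_atTop
            (sub_pos.2 hxt)).eventually_gt_atTop 1] with m hm
          simp only [mem_inter_iff, hx, mem_Iic, not_le.2 hxt, and_false, iff_false]
          intro h
          simp only [dyadicUnion, mem_iUnion, hJ, Finset.mem_filter] at h
          obtain ⟨j, ⟨_, _, hj⟩, hxj⟩ := h
          rw [← mem_dyadicCell.1 hxj] at hj
          have h1 := Int.le_ceil (2 ^ m * x)
          have h2 := Int.ceil_lt_add_one (2 ^ m * t)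
          have h3 : ((⌈2 ^ m * x⌉ : ℤ) : ℝ) ≤ (⌈2 ^ m * t⌉ : ℤ) := by exact_mod_cast hj
          linarith
      · exact Eventually.of_forall fun m =>
          ⟨fun h => absurd (hsub m h) hx, fun h => absurd h.1 hx⟩
  refine Measurable.measure_of_isPiSystem (S := range Iic) ?_ isPiSystem_Iic ?_ ?_
  · rw [← borel_eq_generateFrom_Iic]
    exact BorelSpace.measurable_eq
  · rintro _ ⟨t, rfl⟩
    exact hIic t
  · have : ∀ a, (B a).toMeasure.restrict (Ioc ε 1) univ
        = (B a).toMeasure.restrict (Ioc ε 1) (Iic 1) := fun a => by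
      rw [Measure.restrict_apply_univ, Measure.restrict_apply measurableSet_Iic,
        inter_eq_right.2 fun x hx => hx.2]
    simp_rw [this]
    exact hIic 1

/-- The void events of dyadic sets generate the counts of simple multisets with finite sum. -/
theorem measurable_of_void (hB : ∀ a, (B a).sum ≤ 1) (hB' : ∀ a x, (B a).mult x ≤ 1)
    (hv : ∀ n, ∀ J ⊆ cellIndices n, MeasurableSet {a | (B a).count (dyadicUnion n J) = 0}) :
    Measurable B := by
  refine measurable_of_count fun S hS => ?_
  have hmono : Monotone fun k : ℕ => Ioc (1 / ((k : ℝ) + 1)) 1 := fun k l hkl =>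
    Ioc_subset_Ioc_left (Nat.one_div_le_one_div hkl)
  have hU : ⋃ k : ℕ, Ioc (1 / ((k : ℝ) + 1)) 1 = Ioc 0 1 := by
    ext x
    simp only [mem_iUnion]
    constructor
    · rintro ⟨k, h1, h2⟩
      exact ⟨lt_trans (by positivity) h1, h2⟩
    · rintro ⟨h1, h2⟩
      obtain ⟨k, hk⟩ := exists_nat_one_div_lt h1
      exact ⟨k, hk, h2⟩
  have hcount : ∀ a, (B a).count S
      = ⨆ k : ℕ, (B a).toMeasure.restrict (Ioc (1 / ((k : ℝ) + 1)) 1) S := by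
    intro a
    simp_rw [Measure.restrict_apply hS]
    have hm : Monotone fun k : ℕ => S ∩ Ioc (1 / ((k : ℝ) + 1)) 1 := fun k l hkl =>
      inter_subset_inter_right _ (hmono hkl)
    rw [← hm.measure_iUnion, ← inter_iUnion, hU, ← (B a).toMeasure_apply hS,
      measure_inter_conull (B a).toMeasure_compl_Ioc]
  simp_rw [hcount]
  exact Measurable.iSup fun k => (Measure.measurable_coe hS).comp
    (measurable_restrict_toMeasure hB hB' hv (by positivity))

/-- The empty multiset. -/
def empty : UnitMultiset := ⟨fun _ => 0, fun _ h => absurd rfl h, by simp⟩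

end UnitMultiset

/-- Two laws of random multisets with sum at most `1` and the multi-intensities of the
Poisson–Dirichlet process coincide. -/
theorem eq_of_hasMultiIntensityDensity {θ : ℝ} (hθ : 0 < θ) {Q₁ Q₂ : Measure UnitMultiset}
    [IsProbabilityMeasure Q₁] [IsProbabilityMeasure Q₂]
    (hQ₁ : ∀ᵐ A ∂Q₁, A.sum ≤ 1) (hQ₂ : ∀ᵐ A ∂Q₂, A.sum ≤ 1)
    (h₁ : ∀ k : ℕ, 1 ≤ k → HasMultiIntensityDensity Q₁ id k (pdDensity θ k))
    (h₂ : ∀ k : ℕ, 1 ≤ k → HasMultiIntensityDensity Q₂ id k (pdDensity θ k)) : Q₁ = Q₂ := by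
  classical
  have hae : ∀ᵐ A ∂(Q₁ + Q₂), A.sum ≤ 1 ∧ ∀ x, A.mult x ≤ 1 := by
    rw [ae_add_measure_iff]
    exact ⟨hQ₁.and (ae_mult_le_one hθ hQ₁ h₁), hQ₂.and (ae_mult_le_one hθ hQ₂ h₂)⟩
  -- A measurable conull set for both laws, which avoids proving that simplicity is a measurable
  -- property. Off it `φ` takes the empty multiset, so that the hypotheses of `measurable_of_void`
  -- hold everywhere.
  obtain ⟨G, hGae, hGm, hG⟩ := hae.exists_measurable_mem
  have hGae : ∀ᵐ A ∂(Q₁ + Q₂), A ∈ G := hGae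
  rw [ae_add_measure_iff] at hGae
  set φ : UnitMultiset → UnitMultiset := fun A => if A ∈ G then A else UnitMultiset.empty with hφ
  have hφm : Measurable φ := Measurable.ite hGm measurable_id measurable_const
  have hφs : ∀ A, (φ A).sum ≤ 1 := fun A => by
    by_cases hA : A ∈ G
    · simp only [hφ, if_pos hA]; exact (hG A hA).1
    · simp [hφ, if_neg hA, UnitMultiset.empty, UnitMultiset.sum]
  have hφt : ∀ A x, (φ A).mult x ≤ 1 := fun A x => by
    by_cases hA : A ∈ G
    · simp only [hφ, if_pos hA]; exact (hG A hA).2 x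
    · simp [hφ, if_neg hA, UnitMultiset.empty]
  have hφ₁ : ∀ᵐ A ∂Q₁, φ A = A := hGae.1.mono fun A hA => if_pos hA
  have hφ₂ : ∀ᵐ A ∂Q₂, φ A = A := hGae.2.mono fun A hA => if_pos hA
  set C : Set (Set UnitMultiset) := {V | ∃ n, ∃ J ⊆ cellIndices n,
    V = {A | (φ A).count (dyadicUnion n J) = 0}} with hC
  have hCm : ∀ n J, MeasurableSet {A | (φ A).count (dyadicUnion n J) = 0} := fun n J =>
    ((UnitMultiset.measurable_count (measurableSet_dyadicUnion n J)).comp hφm)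
      (measurableSet_singleton 0)
  have hle : MeasurableSpace.generateFrom C ≤ UnitMultiset.instMeasurableSpace := by
    refine MeasurableSpace.generateFrom_le ?_
    rintro _ ⟨n, J, _, rfl⟩
    exact hCm n J
  have hpi : IsPiSystem C := by
    rintro _ ⟨n, J, hJ, rfl⟩ _ ⟨n', J', hJ', rfl⟩ _
    obtain ⟨K, hK, hKJ⟩ := exists_dyadicUnion_eq (le_max_left n n') hJ
    obtain ⟨K', hK', hKJ'⟩ := exists_dyadicUnion_eq (le_max_right n n') hJ'
    refine ⟨max n n', K ∪ K', Finset.union_subset hK hK', ?_⟩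
    ext A
    simp only [mem_inter_iff, mem_ofPred_eq]
    rw [dyadicUnion_union, UnitMultiset.count_union_eq_zero _ (measurableSet_dyadicUnion _ _)
      (measurableSet_dyadicUnion _ _), hKJ, hKJ']
  have hCeq : ∀ V ∈ C, Q₁ V = Q₂ V := by
    rintro _ ⟨n, J, hJ, rfl⟩
    have e₁ : Q₁ {A | (φ A).count (dyadicUnion n J) = 0}
        = Q₁ {A | A.count (dyadicUnion n J) = 0} :=
      measure_congr (eventuallyEq_set.2 (hφ₁.mono fun A hA => by simp [hA]))
    have e₂ : Q₂ {A | (φ A).count (dyadicUnion n J) = 0}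
        = Q₂ {A | A.count (dyadicUnion n J) = 0} :=
      measure_congr (eventuallyEq_set.2 (hφ₂.mono fun A hA => by simp [hA]))
    rw [e₁, e₂, measure_void_eq θ hθ hQ₁ hQ₂ h₁ h₂ hJ]
  -- The source carries the σ-algebra generated by the void events of `φ`, so every `φ ⁻¹' E`
  -- belongs to it, and the π-λ theorem reaches all events up to null sets.
  have hφC : @Measurable _ _ (MeasurableSpace.generateFrom C) UnitMultiset.instMeasurableSpace φ :=
    @UnitMultiset.measurable_of_void _ (MeasurableSpace.generateFrom C) φ hφs hφt fun n J hJ =>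
      MeasurableSpace.measurableSet_generateFrom ⟨n, J, hJ, rfl⟩
  ext E hE
  have e₁ : Q₁ (φ ⁻¹' E) = Q₁ E :=
    measure_congr (eventuallyEq_set.2 (hφ₁.mono fun A hA => by simp [hA]))
  have e₂ : Q₂ (φ ⁻¹' E) = Q₂ E :=
    measure_congr (eventuallyEq_set.2 (hφ₂.mono fun A hA => by simp [hA]))
  rw [← e₁, ← e₂]
  exact ext_on_measurableSpace_of_generate_finite _ C hCeq hle rfl hpi (by simp) (hφC hE)

theorem hasMultiIntensityDensity_map_iff {Ω : Type*} [MeasurableSpace Ω] {P : Measure Ω}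
    {A : Ω → UnitMultiset} (hA : Measurable A) {k : ℕ} {f : (Fin k → ℝ) → ℝ≥0∞} :
    HasMultiIntensityDensity (P.map A) id k f ↔ HasMultiIntensityDensity P A k f := by
  have h : ∀ a b : Fin k → ℝ, ∫⁻ B, ∏ i, (id B : UnitMultiset).count (Icc (a i) (b i)) ∂(P.map A)
      = ∫⁻ ω, ∏ i, (A ω).count (Icc (a i) (b i)) ∂P := fun a b =>
    lintegral_map (Finset.measurable_fun_prod _ fun i _ =>
      UnitMultiset.measurable_count measurableSet_Icc) hA
  simp only [HasMultiIntensityDensity, h]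

theorem ae_sum_le_one_map_iff {Ω : Type*} [MeasurableSpace Ω] {P : Measure Ω}
    {A : Ω → UnitMultiset} (hA : Measurable A) :
    (∀ᵐ B ∂(P.map A), B.sum ≤ 1) ↔ ∀ᵐ ω ∂P, (A ω).sum ≤ 1 :=
  ae_map_iff hA.aemeasurable (p := fun B : UnitMultiset => B.sum ≤ 1)
    (UnitMultiset.measurable_sum measurableSet_Iic)

end Generation

theorem corollary3p4 (θ : ℝ) (hθ : 0 < θ) :
    IsProbabilityMeasure (poissonDirichletMultiset θ) ∧
    ∀ (Ω : Type*) [MeasurableSpace Ω] (P : Measure Ω) [IsProbabilityMeasure P]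
      (A : Ω → UnitMultiset), Measurable A →
      (P.map A = poissonDirichletMultiset θ ↔
        (∀ᵐ ω ∂P, (A ω).sum ≤ 1) ∧
        ∀ k : ℕ, 1 ≤ k → HasMultiIntensityDensity P A k (pdDensity θ k)) := by
  have hPD := isProbabilityMeasure_poissonDirichletMultiset hθ
  refine ⟨hPD, fun Ω _ P _ A hA => ?_⟩
  simp_rw [← ae_sum_le_one_map_iff hA, ← hasMultiIntensityDensity_map_iff hA]
  constructor
  · intro h
    rw [h]
    exact ⟨ae_sum_le_one_poissonDirichletMultiset hθ,
      fun k _ => hasMultiIntensityDensity_poissonDirichletMultiset hθ k⟩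
  · rintro ⟨h1, h2⟩
    have := Measure.isProbabilityMeasure_map (μ := P) hA.aemeasurable
    exact eq_of_hasMultiIntensityDensity hθ h1 (ae_sum_le_one_poissonDirichletMultiset hθ) h2
      fun k _ => hasMultiIntensityDensity_poissonDirichletMultiset hθ k
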